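/- For each $n\in\mathbb N$ let $p=p_n$ and $k=k_n\ge 1$ be integers, $\lambda^*=\lambda^*_n\in\mathbb{R}$ and $z^*=(z_1^*,\dots,z_p^*)\in(\mathbb{Z}/k\mathbb{Z})^p$; the index $n$ is suppressed. For $a,b\in\mathbb{Z}/k\mathbb{Z}$ let $a\circ b^{-1}\in\{0,1,\dots,k-1\}$ be the representative of $a-b$ modulo $k$, regarded as a real number. We observe a random matrix $Y\in\mathbb{R}^{p\times p}$ with $Y_{ii}=0$ for all $i$ and independent entries $Y_{ij}\sim\mathcal{N}(\lambda^*(z_i^*\circ z_j^{*-1}),1)$ for $i\neq j$. Let $$\ell(z,z^*)=\lambda^{*2}\sum_{j=1}^p\sum_{i=1}^p\left((z_i^*\circ z_j^{-1})-(z_i^*\circ z_j^{*-1})\right)^2 .$$ Starting from a random (possibly data-dependent) $z^{(0)}\in(\mathbb{Z}/k\mathbb{Z})^p$, for $t\ge 1$ let $$\lambda^{(t)}\in\mathop{\rm argmin}_{\lambda\in\mathbb{R}}\sum_{i,j=1}^p\left(Y_{ij}-\lambda(z_i^{(t-1)}\circ (z_j^{(t-1)})^{-1})\right)^2,\qquad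 z_j^{(t)}\in\mathop{\rm argmin}_{a\in\mathbb{Z}/k\mathbb{Z}}\sum_{i=1}^p\left(Y_{ij}-\lambda^{(t)}(z_i^{(t-1)}\circ a^{-1})\right)^2\quad(1\le j\le p),$$ with ties broken arbitrarily. (If the $z^{(t-1)}_i$ are not all equal, then $\lambda^{(t)}=\sum_{i\ne j}Y_{ij}(z_i^{(t-1)}\circ (z_j^{(t-1)})^{-1})\big/\sum_{i\ne j}(z_i^{(t-1)}\circ (z_j^{(t-1)})^{-1})^2$.) Assume that, as $n\to\infty$, $p/k^2\to\infty$ and $p\lambda^{*2}/k^4\to\infty$, and that $\max_{a\in\mathbb{Z}/k\mathbb{Z}}\sum_{j=1}^p\mathbf{1}\{z_j^*=a\}\le(1-\alpha)p$ for some constant $\alpha>0$. Suppose that $\ell(z^{(0)},z^*)=o\left(p^2\lambda^{*2}/k^6\right)$ with probability at least $1-\eta$, that is, there is a deterministic sequence $\rho_n\to 0$ with $\mathbb{P}\left(\ell(z^{(0)},z^*)\le\rho_n\,p^2\lambda^{*2}/k^6\right)\ge 1-\eta_n$ for all $n$. Then there is a deterministic sequence $\varepsilon_n\to0$ such that, for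 every $n$, with probability at least $1-\eta_n-\exp(-\sqrt{p\lambda^{*2}})-e^{-p}$, $$\ell(z^{(t)},z^*)\le p\exp\left(-(1+\varepsilon_n)\frac{p\lambda^{*2}}{8}\right)+\frac12\,\ell(z^{(t-1)},z^*)\qquad\text{for all }t\ge1\text{ simultaneously}.$$ -/

import Mathlib

open MeasureTheory ProbabilityTheory Filter Topology

namespace ZkSync

/-- The real number `a ∘ b⁻¹ = (a - b) mod k ∈ {0, …, k - 1}`. -/
def diff {k : ℕ} (a b : ZMod k) : ℝ := ((a - b).val : ℝ)

/-- The loss `ℓ(z, z*) = λ*² ∑ⱼ ∑ᵢ ((zᵢ* ∘ zⱼ⁻¹) - (zᵢ* ∘ zⱼ*⁻¹))²`. -/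
def loss {p k : ℕ} (lam : ℝ) (z zstar : Fin p → ZMod k) : ℝ :=
  lam ^ 2 * ∑ j, ∑ i, (diff (zstar i) (z j) - diff (zstar i) (zstar j)) ^ 2

/-- The observation model: the off-diagonal entries of `Y` are independent,
`Yᵢⱼ ∼ N(λ* (zᵢ* ∘ zⱼ*⁻¹), 1)` for `i ≠ j`, and the diagonal of `Y` is zero by convention. -/
structure IsModel {Ω : Type*} [MeasurableSpace Ω] (μ : Measure Ω) {p k : ℕ} (lam : ℝ)
    (zstar : Fin p → ZMod k) (Y : Ω → Matrix (Fin p) (Fin p) ℝ) : Prop where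
  diag : ∀ ω i, Y ω i i = 0
  measurable : ∀ i j, Measurable fun ω => Y ω i j
  law : ∀ i j, i ≠ j →
    μ.map (fun ω => Y ω i j) = gaussianReal (lam * diff (zstar i) (zstar j)) 1
  indep : iIndepFun
    (fun (q : {q : Fin p × Fin p // q.1 ≠ q.2}) (ω : Ω) => Y ω q.1.1 q.1.2) μ

/-- `‖Y - 𝒳_z(λ)‖²` in Frobenius norm, where `𝒳_z(λ)ᵢⱼ = λ (zᵢ ∘ zⱼ⁻¹)`. -/
def fitError {p k : ℕ} (Y : Matrix (Fin p) (Fin p) ℝ) (z : Fin p → ZMod k) (lam : ℝ) : ℝ :=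
  ∑ i, ∑ j, (Y i j - lam * diff (z i) (z j)) ^ 2

/-- `∑ᵢ (Yᵢⱼ - λ (zᵢ ∘ a⁻¹))²`, the error of the label `a` for the `j`th column of `Y`. -/
def columnError {p k : ℕ} (Y : Matrix (Fin p) (Fin p) ℝ) (z : Fin p → ZMod k) (lam : ℝ)
    (j : Fin p) (a : ZMod k) : ℝ :=
  ∑ i, (Y i j - lam * diff (z i) a) ^ 2

/-- `z'` is obtained from `z` by one iteration of the algorithm: a least squares estimate `λ`
of the signal strength is computed from `z`, and each `z' j` minimizes the error of the `j`th
column over all labels. Ties are broken arbitrarily in both steps. -/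
def IsStep {p k : ℕ} (Y : Matrix (Fin p) (Fin p) ℝ) (z z' : Fin p → ZMod k) : Prop :=
  ∃ lam : ℝ, (∀ lam' : ℝ, fitError Y z lam ≤ fitError Y z lam') ∧
    ∀ (j : Fin p) (a : ZMod k), columnError Y z lam j (z' j) ≤ columnError Y z lam j a

end ZkSync

/-! The loss after one update splits into a part determined by the noise and `z*` alone and a part
controlled by the current loss. Up to a positive factor, moving column `j` from its true label to
`a` changes the column error by a signal of at least `(1 - δ/2) λ*² gap`, an oracle noise term with
weights taken from `z*`, and `2 λ*` times the noise `P` along `colPerturb`. If the update prefers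
`a`, then either the oracle noise is below `-(1 - δ) λ*² gap`, or `P` absorbs the remaining `δ/2`;
since `gap ≥ p`, the second case gives `λ*² gap ≤ 16 P² / (δ² p)` (`gap_le_of_columnError_le`).

The oracle part does not involve the iterate. The oracle term is sub-Gaussian with variance proxy `4
λ*² gap`, so each error has probability at most `exp(-(1 - δ)² p λ*² / 8)`. This is the source of
the exponent `1/8`; Markov's inequality for `oracleLoss` costs the failure probability `exp(-√(p
λ*²))`.

The iterates depend on the data, so `P` and the error of the estimated signal strength are bounded
uniformly over all labellings with few mismatches. There are at most `exp(2p)` of these and each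
fails with probability at most `exp(-5p)`, leaving room for `exp(-p)`. On the resulting event the
perturbation part is at most half of the current loss (`loss_step_le`), the iterates stay near `z*`
by induction, and the bound holds for all `t` at once. Letting `δ` tend to zero by diagonalization
gives `ε`. -/

namespace ZkSync

/-! ### Exponential moments of sums of squares -/

section Gaussian

lemma lintegral_exp_mul_gaussian (c : ℝ) :
    ∫⁻ x, ENNReal.ofReal (Real.exp (c * x)) ∂(gaussianReal 0 1) =
      ENNReal.ofReal (Real.exp (c ^ 2 / 2)) := by
  rw [← ofReal_integral_eq_lintegral_ofReal (integrable_exp_mul_gaussianReal c)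
    (ae_of_all _ fun x => (Real.exp_pos _).le)]
  have h := congrFun (mgf_id_gaussianReal (μ := 0) (v := 1)) c
  simp only [mgf, id] at h
  rw [h]
  simp

lemma lintegral_exp_sq_gaussian_le :
    ∫⁻ x, ENNReal.ofReal (Real.exp (x ^ 2 / 4)) ∂(gaussianReal 0 1) ≤ 2 := by
  rw [gaussianReal_of_var_ne_zero 0 one_ne_zero,
    lintegral_withDensity_eq_lintegral_mul _ (measurable_gaussianPDF 0 1) (by fun_prop)]
  have h1 : ∀ x : ℝ, (gaussianPDF 0 1 * fun x => ENNReal.ofReal (Real.exp (x ^ 2 / 4))) x =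
      ENNReal.ofReal ((√(2 * Real.pi))⁻¹ * Real.exp (-(1 / 4) * x ^ 2)) := by
    intro x
    simp only [Pi.mul_apply, gaussianPDF]
    rw [← ENNReal.ofReal_mul (gaussianPDFReal_nonneg _ _ _), gaussianPDFReal_def]
    congr 1
    simp only [NNReal.coe_one, mul_one, sub_zero]
    rw [mul_assoc, ← Real.exp_add]
    congr 2
    ring
  simp_rw [h1]
  have hint : Integrable fun x : ℝ => (√(2 * Real.pi))⁻¹ * Real.exp (-(1 / 4) * x ^ 2) :=
    (integrable_exp_neg_mul_sq (by norm_num)).const_mul _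
  rw [← ofReal_integral_eq_lintegral_ofReal hint (ae_of_all _ fun x => by positivity),
    integral_const_mul, integral_gaussian]
  have hle : (√(2 * Real.pi))⁻¹ * √(Real.pi / (1 / 4)) ≤ 2 := by
    have hpos : 0 < √(2 * Real.pi) := by positivity
    rw [inv_mul_le_iff₀ hpos]
    refine Real.sqrt_le_iff.2 ⟨by positivity, ?_⟩
    rw [mul_pow, Real.sq_sqrt (by positivity)]
    nlinarith [Real.pi_pos]
  calc ENNReal.ofReal _ ≤ ENNReal.ofReal 2 := ENNReal.ofReal_le_ofReal hle
    _ = 2 := by simp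

variable {Ω : Type*} [MeasurableSpace Ω] {μ : Measure Ω}

/-- A family whose linear combinations are sub-Gaussian with variance proxy `V` has a bounded
exponential moment of its sum of squares. -/
lemma lintegral_exp_sum_sq_le [SFinite μ] {ι : Type*} [Fintype ι] {G : ι → Ω → ℝ}
    (hG : ∀ j, Measurable (G j)) {V : ℝ} (hV : 0 < V)
    (h : ∀ g : ι → ℝ, ∫⁻ ω, ENNReal.ofReal (Real.exp (∑ j, g j * G j ω)) ∂μ ≤
      ENNReal.ofReal (Real.exp (V * (∑ j, g j ^ 2) / 2))) :
    ∫⁻ ω, ENNReal.ofReal (Real.exp ((∑ j, G j ω ^ 2) / (4 * V))) ∂μ ≤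
      2 ^ Fintype.card ι := by
  -- The square is linearised by averaging over an auxiliary standard Gaussian `x`: `exp (τ² G² / 2)
  -- = E exp (τ x G)`. This `τ` makes `τ² / 2 = 1 / (4V)`, and after the integrals are swapped the
  -- hypothesis leaves `exp (x² / 4)`, which has a finite mean.
  set τ : ℝ := (√(2 * V))⁻¹ with hτ
  have hτ2 : τ ^ 2 = 1 / (2 * V) := by
    rw [hτ, inv_pow, Real.sq_sqrt (by positivity), one_div]
  set γ : Measure (ι → ℝ) := Measure.pi fun _ => gaussianReal 0 1 with hγ
  have hind : ∀ f : ι → ℝ → ENNReal, (∀ j, Measurable (f j)) →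
      ∫⁻ x, ∏ j, f j (x j) ∂γ = ∏ j, ∫⁻ y, f j y ∂(gaussianReal 0 1) := by
    intro f hf
    have hI : iIndepFun (fun j (x : ι → ℝ) => f j (x j)) γ :=
      iIndepFun_pi (μ := fun _ : ι => gaussianReal 0 1) (X := f) fun j => (hf j).aemeasurable
    rw [lintegral_prod_eq_prod_lintegral_of_indepFun Finset.univ
      (fun j (x : ι → ℝ) => f j (x j)) hI fun j => (hf j).comp (measurable_pi_apply j)]
    refine Finset.prod_congr rfl fun j _ => ?_
    exact (measurePreserving_eval (fun _ : ι => gaussianReal 0 1) j).lintegral_comp (hf j)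
  have key : ∀ ω, ENNReal.ofReal (Real.exp ((∑ j, G j ω ^ 2) / (4 * V))) =
      ∫⁻ x, ENNReal.ofReal (Real.exp (∑ j, τ * x j * G j ω)) ∂γ := by
    intro ω
    have e1 : ∀ x : ι → ℝ, ENNReal.ofReal (Real.exp (∑ j, τ * x j * G j ω)) =
        ∏ j, ENNReal.ofReal (Real.exp (τ * G j ω * x j)) := by
      intro x
      rw [Real.exp_sum, ENNReal.ofReal_prod_of_nonneg fun _ _ => (Real.exp_pos _).le]
      exact Finset.prod_congr rfl fun j _ => by ring_nf
    simp_rw [e1]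
    rw [hind (fun j y => ENNReal.ofReal (Real.exp (τ * G j ω * y))) fun j => by fun_prop]
    simp_rw [lintegral_exp_mul_gaussian]
    rw [← ENNReal.ofReal_prod_of_nonneg fun _ _ => (Real.exp_pos _).le, ← Real.exp_sum]
    congr 2
    rw [Finset.sum_div]
    refine Finset.sum_congr rfl fun j _ => ?_
    rw [mul_pow, hτ2]
    field_simp
    ring
  simp_rw [key]
  rw [lintegral_lintegral_swap (by fun_prop)]
  calc ∫⁻ x, ∫⁻ ω, ENNReal.ofReal (Real.exp (∑ j, τ * x j * G j ω)) ∂μ ∂γ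
      ≤ ∫⁻ x, ∏ j, ENNReal.ofReal (Real.exp (x j ^ 2 / 4)) ∂γ := by
        refine lintegral_mono fun x => (h fun j => τ * x j).trans_eq ?_
        rw [← ENNReal.ofReal_prod_of_nonneg fun _ _ => (Real.exp_pos _).le, ← Real.exp_sum]
        congr 2
        simp_rw [mul_pow, ← Finset.mul_sum, hτ2, ← Finset.sum_div]
        field_simp
        ring
    _ = ∏ j : ι, ∫⁻ y, ENNReal.ofReal (Real.exp (y ^ 2 / 4)) ∂(gaussianReal 0 1) :=
        hind (fun _ y => ENNReal.ofReal (Real.exp (y ^ 2 / 4))) fun j => by fun_prop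
    _ ≤ ∏ _j : ι, 2 := Finset.prod_le_prod' fun j _ => lintegral_exp_sq_gaussian_le
    _ = 2 ^ Fintype.card ι := by simp

lemma measureReal_sum_sq_ge_le [IsProbabilityMeasure μ] {ι : Type*} [Fintype ι] {G : ι → Ω → ℝ}
    (hG : ∀ j, Measurable (G j)) {V : ℝ} (hV : 0 < V)
    (h : ∀ g : ι → ℝ, ∫⁻ ω, ENNReal.ofReal (Real.exp (∑ j, g j * G j ω)) ∂μ ≤
      ENNReal.ofReal (Real.exp (V * (∑ j, g j ^ 2) / 2))) (x : ℝ) :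
    μ.real {ω | 4 * V * x ≤ ∑ j, G j ω ^ 2} ≤ 2 ^ Fintype.card ι * Real.exp (-x) := by
  have h1 := lintegral_exp_sum_sq_le hG hV h
  have h2 := meas_ge_le_lintegral_div (μ := μ)
    (f := fun ω => ENNReal.ofReal (Real.exp ((∑ j, G j ω ^ 2) / (4 * V)))) (by fun_prop)
    (ε := ENNReal.ofReal (Real.exp x)) (by simp [Real.exp_pos]) (by simp)
  have hset : {ω | ENNReal.ofReal (Real.exp x) ≤
      ENNReal.ofReal (Real.exp ((∑ j, G j ω ^ 2) / (4 * V)))} =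
      {ω | 4 * V * x ≤ ∑ j, G j ω ^ 2} := by
    ext ω
    simp only [Set.mem_ofPred_eq]
    rw [ENNReal.ofReal_le_ofReal_iff (Real.exp_pos _).le, Real.exp_le_exp,
      le_div_iff₀ (by positivity), mul_comm]
  rw [hset] at h2
  have h3 : μ {ω | 4 * V * x ≤ ∑ j, G j ω ^ 2} ≤
      ENNReal.ofReal (2 ^ Fintype.card ι * Real.exp (-x)) := by
    refine h2.trans ((ENNReal.div_le_div_right h1 _).trans_eq ?_)
    rw [Real.exp_neg, ← div_eq_mul_inv, ENNReal.ofReal_div_of_pos (Real.exp_pos _),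
      ENNReal.ofReal_pow (by norm_num)]
    simp
  exact ENNReal.toReal_le_of_le_ofReal (by positivity) h3

end Gaussian

/-! ### Sub-Gaussian linear forms of the noise -/

section Model

variable {Ω : Type*} [MeasurableSpace Ω] {μ : Measure Ω} {p k : ℕ}

/-- The noise `Y - λ* (zᵢ* ∘ zⱼ*⁻¹)`. -/
def noise (lam : ℝ) (zstar : Fin p → ZMod k) (Y : Matrix (Fin p) (Fin p) ℝ) (i j : Fin p) : ℝ :=
  Y i j - lam * diff (zstar i) (zstar j)

lemma diff_self (a : ZMod k) : diff a a = 0 := by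
  simp [diff]

lemma IsModel.noise_diag {lam : ℝ} {zstar : Fin p → ZMod k} {Y : Ω → Matrix (Fin p) (Fin p) ℝ}
    (hY : IsModel μ lam zstar Y) (ω : Ω) (i : Fin p) : noise lam zstar (Y ω) i i = 0 := by
  simp [noise, hY.diag, diff_self]

lemma IsModel.measurable_noise {lam : ℝ} {zstar : Fin p → ZMod k}
    {Y : Ω → Matrix (Fin p) (Fin p) ℝ} (hY : IsModel μ lam zstar Y) (i j : Fin p) :
    Measurable fun ω => noise lam zstar (Y ω) i j :=
  (hY.measurable i j).sub_const _

lemma hasSubgaussianMGF_of_map_eq_gaussianReal [IsProbabilityMeasure μ] {X : Ω → ℝ}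
    (h : μ.map X = gaussianReal 0 1) :
    HasSubgaussianMGF X 1 μ where
  integrable_exp_mul t := by
    rw [← mgf_pos_iff, mgf_gaussianReal h]
    exact Real.exp_pos _
  mgf_le t := by simp [mgf_gaussianReal h]

/-- The off-diagonal terms are independent centred Gaussians, and the noise vanishes on the
diagonal, so the sum may run over all pairs. -/
lemma IsModel.hasSubgaussianMGF_sum_noise [IsProbabilityMeasure μ]
    {lam : ℝ} {zstar : Fin p → ZMod k}
    {Y : Ω → Matrix (Fin p) (Fin p) ℝ} (hY : IsModel μ lam zstar Y)
    (c : Fin p → Fin p → ℝ) {V : NNReal} (hV : ∑ j, ∑ i, c i j ^ 2 ≤ V) :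
    HasSubgaussianMGF (fun ω => ∑ j, ∑ i, c i j * noise lam zstar (Y ω) i j) V μ := by
  classical
  let Q := {q : Fin p × Fin p // q.1 ≠ q.2}
  have hind : iIndepFun (fun (q : Q) ω => c q.1.1 q.1.2 * noise lam zstar (Y ω) q.1.1 q.1.2) μ :=
    hY.indep.comp
      (fun q y => c q.1.1 q.1.2 * (y - lam * diff (zstar q.1.1) (zstar q.1.2)))
      fun q => by fun_prop
  have hsub : ∀ q : Q, HasSubgaussianMGF
      (fun ω => c q.1.1 q.1.2 * noise lam zstar (Y ω) q.1.1 q.1.2)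
      (c q.1.1 q.1.2 ^ 2).toNNReal μ := by
    intro q
    have h0 : (c q.1.1 q.1.2 ^ 2).toNNReal = NNReal.mk (c q.1.1 q.1.2 ^ 2) (sq_nonneg _) * 1 := by
      rw [mul_one, Real.toNNReal_of_nonneg (sq_nonneg _)]
    rw [h0]
    refine HasSubgaussianMGF.const_mul (hasSubgaussianMGF_of_map_eq_gaussianReal ?_) _
    have h1 : (fun ω => noise lam zstar (Y ω) q.1.1 q.1.2) =
        (· - lam * diff (zstar q.1.1) (zstar q.1.2)) ∘ fun ω => Y ω q.1.1 q.1.2 := rfl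
    rw [h1, ← Measure.map_map (by fun_prop) (hY.measurable _ _), hY.law _ _ q.2,
      gaussianReal_map_sub_const, sub_self]
  have hsum := HasSubgaussianMGF.sum_of_iIndepFun hind (s := Finset.univ) fun q _ => hsub q
  have hre : ∀ f : Fin p → Fin p → ℝ, (∀ i, f i i = 0) →
      ∑ q : Q, f q.1.1 q.1.2 = ∑ j, ∑ i, f i j := by
    intro f hf
    rw [Finset.sum_comm, ← Fintype.sum_prod_type' (f := f)]
    rw [← Finset.sum_subtype (Finset.univ.filter fun q : Fin p × Fin p => q.1 ≠ q.2)
      (by simp) (fun q => f q.1 q.2)]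
    refine Finset.sum_filter_of_ne ?_
    rintro ⟨i, j⟩ - h hij
    obtain rfl : i = j := hij
    exact h (hf i)
  have hfun : (fun ω => ∑ q : Q, c q.1.1 q.1.2 * noise lam zstar (Y ω) q.1.1 q.1.2) =
      fun ω => ∑ j, ∑ i, c i j * noise lam zstar (Y ω) i j := by
    funext ω
    exact hre (fun i j => c i j * noise lam zstar (Y ω) i j)
      fun i => by simp [hY.noise_diag]
  rw [hfun] at hsum
  refine ⟨hsum.integrable_exp_mul, fun t => (hsum.mgf_le t).trans ?_⟩
  have hc : ((∑ q : Q, (c q.1.1 q.1.2 ^ 2).toNNReal : NNReal) : ℝ) ≤ V := by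
    simp only [NNReal.coe_sum, Real.coe_toNNReal _ (sq_nonneg _)]
    refine le_trans ?_ hV
    calc ∑ q : Q, c q.1.1 q.1.2 ^ 2
        = ∑ q : Q, (if q.1.1 = q.1.2 then 0 else c q.1.1 q.1.2 ^ 2) :=
          Finset.sum_congr rfl fun q _ => by simp [q.2]
      _ = ∑ j, ∑ i, (if i = j then 0 else c i j ^ 2) :=
          hre (fun i j => if i = j then 0 else c i j ^ 2) (by simp)
      _ ≤ ∑ j, ∑ i, c i j ^ 2 := by
          gcongr with j _ i _
          split_ifs
          · positivity
          · exact le_rfl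
  gcongr

end Model

/-! ### Separation of labels, and the loss -/

section Loss

variable {p k : ℕ}

lemma diff_nonneg (a b : ZMod k) : 0 ≤ diff a b := Nat.cast_nonneg _

lemma diff_le [NeZero k] (a b : ZMod k) : diff a b ≤ k := by
  unfold diff
  exact_mod_cast (ZMod.val_lt (a - b)).le

lemma abs_diff_sub_diff_le [NeZero k] (a b c d : ZMod k) : |diff a b - diff c d| ≤ k :=
  abs_sub_le_of_nonneg_of_le (diff_nonneg _ _) (diff_le _ _) (diff_nonneg _ _) (diff_le _ _)

/-- Representatives of distinct residues are distinct integers. Every row therefore separates two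
labels by at least `1`, which makes `gap` at least `p`. -/
lemma one_le_diff_sub_diff_sq [NeZero k] (x : ZMod k) {a b : ZMod k} (h : a ≠ b) :
    1 ≤ (diff x a - diff x b) ^ 2 := by
  have h1 : ((x - a).val : ℤ) - ((x - b).val : ℤ) ≠ 0 := by
    intro h0
    have h2 : (x - a).val = (x - b).val := by omega
    exact h (sub_right_injective (ZMod.val_injective k h2))
  have h3 : (1 : ℤ) ≤ (((x - a).val : ℤ) - ((x - b).val : ℤ)) ^ 2 := by
    have := Int.one_le_abs h1
    rw [← sq_abs]
    nlinarith
  unfold diff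
  exact_mod_cast h3

lemma one_le_diff_sq [NeZero k] {a b : ZMod k} (h : a ≠ b) : 1 ≤ diff a b ^ 2 := by
  simpa [diff_self] using one_le_diff_sub_diff_sq a h.symm

/-- The set of indices at which `z` and `z*` disagree. -/
def mismatch (z zstar : Fin p → ZMod k) : Finset (Fin p) :=
  Finset.univ.filter fun i => z i ≠ zstar i

lemma mem_mismatch {z zstar : Fin p → ZMod k} {i : Fin p} :
    i ∈ mismatch z zstar ↔ z i ≠ zstar i := by simp [mismatch]

/-- The squared separation `∑ᵢ ((zᵢ* ∘ zⱼ*⁻¹) - (zᵢ* ∘ a⁻¹))²` between the `j`th column and the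
column with label `a`. -/
def gap (zstar : Fin p → ZMod k) (j : Fin p) (a : ZMod k) : ℝ :=
  ∑ i, (diff (zstar i) (zstar j) - diff (zstar i) a) ^ 2

lemma gap_nonneg (zstar : Fin p → ZMod k) (j : Fin p) (a : ZMod k) : 0 ≤ gap zstar j a :=
  Finset.sum_nonneg fun _ _ => sq_nonneg _

lemma gap_self (zstar : Fin p → ZMod k) (j : Fin p) : gap zstar j (zstar j) = 0 := by
  simp [gap]

lemma le_gap [NeZero k] (zstar : Fin p → ZMod k) {j : Fin p} {a : ZMod k} (h : a ≠ zstar j) :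
    (p : ℝ) ≤ gap zstar j a := by
  calc (p : ℝ) = ∑ _i : Fin p, (1 : ℝ) := by simp
    _ ≤ gap zstar j a := Finset.sum_le_sum fun i _ => one_le_diff_sub_diff_sq _ h.symm

lemma gap_le [NeZero k] (zstar : Fin p → ZMod k) (j : Fin p) (a : ZMod k) :
    gap zstar j a ≤ p * (k : ℝ) ^ 2 := by
  calc gap zstar j a ≤ ∑ _i : Fin p, (k : ℝ) ^ 2 :=
        Finset.sum_le_sum fun i _ => sq_le_sq' (abs_le.1 (abs_diff_sub_diff_le _ _ _ _)).1
          (abs_le.1 (abs_diff_sub_diff_le _ _ _ _)).2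
    _ = p * (k : ℝ) ^ 2 := by simp

lemma loss_eq_sum_gap (lam : ℝ) (z zstar : Fin p → ZMod k) :
    loss lam z zstar = ∑ j, lam ^ 2 * gap zstar j (z j) := by
  unfold loss gap
  rw [Finset.mul_sum]
  simp_rw [sub_sq_comm]

lemma loss_nonneg (lam : ℝ) (z zstar : Fin p → ZMod k) : 0 ≤ loss lam z zstar := by
  unfold loss
  positivity

lemma card_mismatch_le_loss [NeZero k] (lam : ℝ) (z zstar : Fin p → ZMod k) :
    p * lam ^ 2 * (mismatch z zstar).card ≤ loss lam z zstar := by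
  rw [loss_eq_sum_gap]
  calc p * lam ^ 2 * (mismatch z zstar).card
      = ∑ _j ∈ mismatch z zstar, lam ^ 2 * p := by
        rw [Finset.sum_const, nsmul_eq_mul]
        ring
    _ ≤ ∑ j ∈ mismatch z zstar, lam ^ 2 * gap zstar j (z j) := by
        gcongr with j hj
        exact le_gap _ (mem_mismatch.1 hj)
    _ ≤ ∑ j, lam ^ 2 * gap zstar j (z j) :=
        Finset.sum_le_sum_of_subset_of_nonneg (Finset.subset_univ _)
          fun j _ _ => mul_nonneg (sq_nonneg _) (gap_nonneg _ _ _)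

lemma loss_le [NeZero k] (lam : ℝ) (z zstar : Fin p → ZMod k) :
    loss lam z zstar ≤ lam ^ 2 * (p ^ 2 * (k : ℝ) ^ 2) := by
  rw [loss_eq_sum_gap]
  calc ∑ j, lam ^ 2 * gap zstar j (z j) ≤ ∑ _j : Fin p, lam ^ 2 * (p * (k : ℝ) ^ 2) := by
        gcongr with j
        exact gap_le _ _ _
    _ = lam ^ 2 * (p ^ 2 * (k : ℝ) ^ 2) := by
        simp
        ring

end Loss

/-! ### Accuracy of the least squares signal strength -/

section SignalStrength

variable {p k : ℕ}

/-- The squared Frobenius norm of `𝒳_z(1)`. -/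
def designSq (z : Fin p → ZMod k) : ℝ := ∑ j, ∑ i, diff (z i) (z j) ^ 2

lemma fitError_eq (Y : Matrix (Fin p) (Fin p) ℝ) (z : Fin p → ZMod k) (l : ℝ) :
    fitError Y z l = ∑ j, ∑ i, Y i j ^ 2 - 2 * l * ∑ j, ∑ i, Y i j * diff (z i) (z j) +
      l ^ 2 * designSq z := by
  unfold fitError designSq
  rw [Finset.sum_comm]
  simp_rw [Finset.mul_sum, ← Finset.sum_sub_distrib, ← Finset.sum_add_distrib]
  refine Finset.sum_congr rfl fun i _ => Finset.sum_congr rfl fun j _ => ?_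
  ring

lemma mul_designSq_of_forall_fitError_le {Y : Matrix (Fin p) (Fin p) ℝ} {z : Fin p → ZMod k}
    {l : ℝ} (hl : ∀ l', fitError Y z l ≤ fitError Y z l') (hA : 0 < designSq z) :
    l * designSq z = ∑ j, ∑ i, Y i j * diff (z i) (z j) := by
  have h := hl ((∑ j, ∑ i, Y i j * diff (z i) (z j)) / designSq z)
  rw [fitError_eq, fitError_eq] at h
  set A := designSq z
  set B := ∑ j, ∑ i, Y i j * diff (z i) (z j)
  have h1 : (l * A - B) ^ 2 ≤ 0 := by
    have h2 : l ^ 2 * A - 2 * l * B ≤ (B / A) ^ 2 * A - 2 * (B / A) * B := by linarith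
    have h3 : (B / A) ^ 2 * A - 2 * (B / A) * B = - (B ^ 2 / A) := by
      field_simp
      ring
    rw [h3] at h2
    have h4 : (l ^ 2 * A - 2 * l * B) * A ≤ - (B ^ 2 / A) * A :=
      mul_le_mul_of_nonneg_right h2 hA.le
    have h5 : - (B ^ 2 / A) * A = - B ^ 2 := by
      field_simp
    nlinarith
  have h6 : l * A - B = 0 := by
    exact pow_eq_zero_iff two_ne_zero |>.1 (le_antisymm h1 (sq_nonneg _))
  linarith

lemma sum_indicator_mismatch (z zstar : Fin p → ZMod k) (c : ℝ) :
    ∑ j : Fin p, ∑ i : Fin p, c * ((if i ∈ mismatch z zstar then 1 else 0) +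
      (if j ∈ mismatch z zstar then 1 else 0)) = 2 * c * (p * (mismatch z zstar).card) := by
  simp_rw [← Finset.mul_sum, Finset.sum_add_distrib]
  simp
  ring

lemma one_le_indicator_mismatch {z zstar : Fin p → ZMod k} {i j : Fin p}
    (hij : ¬ (z i = zstar i ∧ z j = zstar j)) :
    (1 : ℝ) ≤ (if i ∈ mismatch z zstar then 1 else 0) +
      (if j ∈ mismatch z zstar then 1 else 0) := by
  simp only [mem_mismatch]
  split_ifs <;> simp_all

/-- By balance at least `α p²` ordered pairs have different true labels, and each contributes at
least `1`. A mismatched index spoils at most `2p` pairs. -/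
lemma le_designSq [NeZero k] {z zstar : Fin p → ZMod k} {α : ℝ}
    (hbal : ∀ a, ((Finset.univ.filter fun j => zstar j = a).card : ℝ) ≤ (1 - α) * p) :
    α * p ^ 2 - 2 * (p * (mismatch z zstar).card) ≤ designSq z := by
  have h1 : α * (p : ℝ) ^ 2 ≤ ∑ j : Fin p, ∑ i : Fin p, 
      (if zstar i = zstar j then (0 : ℝ) else 1) := by
    calc α * (p : ℝ) ^ 2 = ∑ _j : Fin p, α * p := by
          simp
          ring
      _ ≤ _ := by
          gcongr with j _
          have h2 : ∑ i : Fin p, (if zstar i = zstar j then (0 : ℝ) else 1) =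
              p - ∑ i : Fin p, (if zstar i = zstar j then (1 : ℝ) else 0) := by
            rw [eq_sub_iff_add_eq, ← Finset.sum_add_distrib]
            calc _ = ∑ _i : Fin p, (1 : ℝ) :=
                  Finset.sum_congr rfl fun i _ => by split_ifs <;> simp
              _ = p := by simp
          rw [h2, Finset.sum_boole]
          have := hbal (zstar j)
          linarith
  have h3 := sum_indicator_mismatch z zstar 1
  have h4 : ∑ j : Fin p, ∑ i : Fin p, ((if zstar i = zstar j then (0 : ℝ) else 1) -
      1 * ((if i ∈ mismatch z zstar then 1 else 0) + (if j ∈ mismatch z zstar then 1 else 0))) ≤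
      designSq z := by
    unfold designSq
    gcongr with j _ i _
    by_cases hij : z i = zstar i ∧ z j = zstar j
    · have hi : i ∉ mismatch z zstar := by simp [mem_mismatch, hij.1]
      have hj : j ∉ mismatch z zstar := by simp [mem_mismatch, hij.2]
      rw [if_neg hi, if_neg hj, hij.1, hij.2]
      split_ifs with h
      · simp [h, diff_self]
      · simpa using one_le_diff_sq h
    · have h5 := one_le_indicator_mismatch hij
      have h6 := sq_nonneg (diff (z i) (z j))
      split_ifs at * <;> linarith
  simp_rw [Finset.sum_sub_distrib] at h4
  rw [h3] at h4
  linarith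

/-- The least squares estimate of the signal strength has small relative error. -/
lemma abs_ratio_sub_one_le [NeZero k] {Y : Matrix (Fin p) (Fin p) ℝ} {z zstar : Fin p → ZMod k}
    {lam l α C κ : ℝ} (hl : ∀ l', fitError Y z l ≤ fitError Y z l') (hα : 0 < α) (hp : 0 < p)
    (hlam : lam ≠ 0)
    (hbal : ∀ a, ((Finset.univ.filter fun j => zstar j = a).card : ℝ) ≤ (1 - α) * p)
    (hh : 4 * ((mismatch z zstar).card : ℝ) ≤ α * p)
    (hnoise : (∑ j, ∑ i, diff (z i) (z j) * noise lam zstar Y i j) ^ 2 ≤ C * p * designSq z)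
    (hκ : 0 ≤ κ) (hκ1 : 8 * ((mismatch z zstar).card * (k : ℝ) ^ 2) ≤ κ * (α * p))
    (hκ2 : 8 * C ≤ κ ^ 2 * (α * (p * lam ^ 2))) :
    |l / lam - 1| ≤ κ := by
  have hp' : (0 : ℝ) < p := by exact_mod_cast hp
  set h : ℝ := ((mismatch z zstar).card : ℝ) with hh_def
  set A := designSq z with hA
  have hA1 : α * (p : ℝ) ^ 2 / 2 ≤ A := by
    have := le_designSq (z := z) hbal
    rw [← hA, ← hh_def] at this
    nlinarith
  have hA0 : 0 < A := lt_of_lt_of_le (by positivity) hA1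
  have hB := mul_designSq_of_forall_fitError_le hl hA0
  rw [← hA] at hB
  set N := ∑ j, ∑ i, diff (z i) (z j) * noise lam zstar Y i j with hN
  set E := ∑ j, ∑ i, (diff (zstar i) (zstar j) - diff (z i) (z j)) * diff (z i) (z j) with hE
  have hBE : l * A = lam * A + lam * E + N := by
    rw [hB, hA, hE, hN, designSq]
    simp_rw [Finset.mul_sum, ← Finset.sum_add_distrib]
    refine Finset.sum_congr rfl fun j _ => Finset.sum_congr rfl fun i _ => ?_
    unfold noise
    ring
  -- Only pairs containing a mismatched index contribute to the bias `E`, each at most `k²`. Bias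
  -- and noise will each receive half of the relative error `κ`.
  have hEle : |E| ≤ 2 * (k : ℝ) ^ 2 * (p * h) := by
    rw [hh_def, ← sum_indicator_mismatch]
    refine (Finset.abs_sum_le_sum_abs _ _).trans (Finset.sum_le_sum fun j _ => ?_)
    refine (Finset.abs_sum_le_sum_abs _ _).trans (Finset.sum_le_sum fun i _ => ?_)
    by_cases hij : z i = zstar i ∧ z j = zstar j
    · rw [hij.1, hij.2]
      simp only [sub_self, zero_mul, abs_zero]
      positivity
    · have h1 := one_le_indicator_mismatch hij
      calc |(diff (zstar i) (zstar j) - diff (z i) (z j)) * diff (z i) (z j)|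
          ≤ k * k := by
            rw [abs_mul, abs_of_nonneg (diff_nonneg (z i) (z j))]
            exact mul_le_mul (abs_diff_sub_diff_le _ _ _ _) (diff_le _ _) (diff_nonneg _ _)
              (Nat.cast_nonneg _)
        _ = (k : ℝ) ^ 2 * 1 := by ring
        _ ≤ _ := by gcongr
  have hE2 : |E| ≤ κ / 2 * A := by
    refine hEle.trans ?_
    calc 2 * (k : ℝ) ^ 2 * (p * h) = (8 * (h * (k : ℝ) ^ 2)) * (p / 4) := by ring
      _ ≤ κ * (α * p) * (p / 4) := by gcongr
      _ = κ / 2 * (α * (p : ℝ) ^ 2 / 2) := by ring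
      _ ≤ κ / 2 * A := by gcongr
  have hN2 : |N| ≤ |lam| * (κ / 2 * A) := by
    refine abs_le_of_sq_le_sq ?_ (by positivity)
    calc N ^ 2 ≤ C * p * A := hnoise
      _ = (8 * C) * (p * A / 8) := by ring
      _ ≤ κ ^ 2 * (α * (p * lam ^ 2)) * (p * A / 8) := by gcongr
      _ = lam ^ 2 * κ ^ 2 / 4 * A * (α * (p : ℝ) ^ 2 / 2) := by ring
      _ ≤ lam ^ 2 * κ ^ 2 / 4 * A * A := by gcongr
      _ = (|lam| * (κ / 2 * A)) ^ 2 := by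
        rw [mul_pow, sq_abs]
        ring
  have hr : (l / lam - 1) * (lam * A) = lam * E + N := by
    field_simp
    linarith
  have hlam' : 0 < |lam| := abs_pos.2 hlam
  have h5 : |l / lam - 1| * (|lam| * A) ≤ κ * (|lam| * A) := by
    calc |l / lam - 1| * (|lam| * A) = |lam * E + N| := by
          rw [← hr, abs_mul, abs_mul, abs_of_pos hA0]
      _ ≤ |lam| * |E| + |N| := by
          rw [← abs_mul]
          exact abs_add_le _ _
      _ ≤ |lam| * (κ / 2 * A) + |lam| * (κ / 2 * A) := by gcongr
      _ = κ * (|lam| * A) := by ring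
  exact le_of_mul_le_mul_right h5 (by positivity)

end SignalStrength

/-! ### Deterministic analysis of one iteration -/

section Step

variable {p k : ℕ}

/-- The error made when `z*` is replaced by `z` in the difference of the columns with labels
`zⱼ*` and `a`. -/
def colPerturb (z zstar : Fin p → ZMod k) (a : ZMod k) (j i : Fin p) : ℝ :=
  (diff (z i) (zstar j) - diff (z i) a) - (diff (zstar i) (zstar j) - diff (zstar i) a)

lemma sum_colPerturb_sq_le [NeZero k] (z zstar : Fin p → ZMod k) (a : ZMod k) (j : Fin p) :
    ∑ i, colPerturb z zstar a j i ^ 2 ≤ 4 * (k : ℝ) ^ 2 * (mismatch z zstar).card := by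
  calc ∑ i, colPerturb z zstar a j i ^ 2
      ≤ ∑ i, 4 * (k : ℝ) ^ 2 * (if i ∈ mismatch z zstar then 1 else 0) := by
        gcongr with i
        split_ifs with hi
        · have h1 := abs_le.1 (abs_diff_sub_diff_le (z i) (zstar j) (z i) a)
          have h2 := abs_le.1 (abs_diff_sub_diff_le (zstar i) (zstar j) (zstar i) a)
          rw [mul_one, show 4 * (k : ℝ) ^ 2 = (2 * (k : ℝ)) ^ 2 by ring]
          unfold colPerturb
          refine sq_le_sq' ?_ ?_ <;> linarith
        · have h : z i = zstar i := by simpa [mem_mismatch] using hi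
          simp [colPerturb, h]
    _ = 4 * (k : ℝ) ^ 2 * (mismatch z zstar).card := by
        rw [← Finset.mul_sum]
        simp

/-- The event that the noise in the `j`th column makes `a` preferable to the true label even if
the other labels and the signal strength are (almost) known. -/
def OracleError (lam δ : ℝ) (zstar : Fin p → ZMod k) (Y : Matrix (Fin p) (Fin p) ℝ) (j : Fin p)
    (a : ZMod k) : Prop :=
  2 * lam * ∑ i, (diff (zstar i) (zstar j) - diff (zstar i) a) * noise lam zstar Y i j ≤
    -((1 - δ) * (lam ^ 2 * gap zstar j a))

open Classical in
/-- The loss caused by oracle errors. -/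
noncomputable def oracleLoss [NeZero k] (lam δ : ℝ) (zstar : Fin p → ZMod k)
    (Y : Matrix (Fin p) (Fin p) ℝ) : ℝ :=
  ∑ j, ∑ a : ZMod k, if OracleError lam δ zstar Y j a then lam ^ 2 * gap zstar j a else 0

lemma columnError_sub (Y : Matrix (Fin p) (Fin p) ℝ) (z zstar : Fin p → ZMod k) (lam r : ℝ)
    (j : Fin p) (a : ZMod k) :
    columnError Y z (r * lam) j a - columnError Y z (r * lam) j (zstar j) =
      r * (2 * lam * ∑ i, (diff (z i) (zstar j) - diff (z i) a) * noise lam zstar Y i j +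
        lam ^ 2 * ∑ i, (2 * (diff (zstar i) (zstar j) - r * diff (z i) (zstar j)) *
          (diff (z i) (zstar j) - diff (z i) a) +
          r * (diff (z i) (zstar j) - diff (z i) a) ^ 2)) := by
  unfold columnError noise
  simp_rw [Finset.mul_sum, ← Finset.sum_sub_distrib, ← Finset.sum_add_distrib, Finset.mul_sum]
  refine Finset.sum_congr rfl fun i _ => ?_
  ring

/-- Termwise estimate. At a mismatched index the cross term costs `2 k²` and replacing the true
squared difference costs `k²`; the error in `r` costs at most `2 κ k²` at every index. -/
lemma le_sum_signal [NeZero k] (z zstar : Fin p → ZMod k) {r κ : ℝ} (hr : |r - 1| ≤ κ)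
    (hκ : κ ≤ 1) (j : Fin p) (a : ZMod k) :
    (1 - κ) * gap zstar j a - 3 * (k : ℝ) ^ 2 * (mismatch z zstar).card -
      2 * κ * (p * (k : ℝ) ^ 2) ≤
    ∑ i, (2 * (diff (zstar i) (zstar j) - r * diff (z i) (zstar j)) *
      (diff (z i) (zstar j) - diff (z i) a) + r * (diff (z i) (zstar j) - diff (z i) a) ^ 2) := by
  have hk : (0 : ℝ) ≤ k := Nat.cast_nonneg k
  have hr' := abs_le.1 hr
  have hκ0 : 0 ≤ κ := (abs_nonneg _).trans hr
  have h1 : ∑ i, ((1 - κ) * (diff (zstar i) (zstar j) - diff (zstar i) a) ^ 2 -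
      3 * (k : ℝ) ^ 2 * (if i ∈ mismatch z zstar then 1 else 0) - 2 * κ * (k : ℝ) ^ 2) =
      (1 - κ) * gap zstar j a - 3 * (k : ℝ) ^ 2 * (mismatch z zstar).card -
      2 * κ * (p * (k : ℝ) ^ 2) := by
    rw [Finset.sum_sub_distrib, Finset.sum_sub_distrib, ← Finset.mul_sum, ← Finset.mul_sum, gap]
    simp
    ring
  rw [← h1]
  gcongr with i
  set u := diff (z i) (zstar j) with hu
  set d := diff (z i) (zstar j) - diff (z i) a with hd
  have hdk : |d| ≤ k := abs_diff_sub_diff_le _ _ _ _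
  have huk : |u| ≤ k := by
    rw [abs_of_nonneg (diff_nonneg _ _)]
    exact diff_le _ _
  have hud : |(r - 1) * (u * d)| ≤ κ * (k * k) := by
    rw [abs_mul, abs_mul]
    gcongr
  have hud' := (abs_le.1 hud).2
  have hrd : (1 - κ) * d ^ 2 ≤ r * d ^ 2 := mul_le_mul_of_nonneg_right (by linarith) (sq_nonneg _)
  split_ifs with hi
  · have h3 : |(diff (zstar i) (zstar j) - u) * d| ≤ k * k := by
      rw [abs_mul]
      have := abs_diff_sub_diff_le (zstar i) (zstar j) (z i) (zstar j)
      gcongr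
    have h3' := (abs_le.1 h3).1
    have h4 : (diff (zstar i) (zstar j) - diff (zstar i) a) ^ 2 ≤ (k : ℝ) ^ 2 :=
      sq_le_sq' (abs_le.1 (abs_diff_sub_diff_le _ _ _ _)).1
        (abs_le.1 (abs_diff_sub_diff_le _ _ _ _)).2
    have h5 : (1 - κ) * (diff (zstar i) (zstar j) - diff (zstar i) a) ^ 2 ≤ 1 * (k : ℝ) ^ 2 :=
      mul_le_mul (by linarith) h4 (sq_nonneg _) zero_le_one
    have h6 : 0 ≤ (1 - κ) * d ^ 2 := mul_nonneg (by linarith) (sq_nonneg _)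
    nlinarith
  · have h : z i = zstar i := by simpa [mem_mismatch] using hi
    rw [← h, ← hu, ← hd]
    nlinarith

/-- A column that is relabelled as `a` either suffers from an oracle error or from the noise along
the perturbation caused by the current mislabelled indices. -/
lemma gap_le_of_columnError_le [NeZero k] {Y : Matrix (Fin p) (Fin p) ℝ}
    {z zstar : Fin p → ZMod k} {lam r δ κ : ℝ} {j : Fin p} {a : ZMod k} (hlam : lam ≠ 0)
    (hp : 0 < p) (hδ : 0 < δ) (hδ1 : δ ≤ 1) (hr : |r - 1| ≤ κ) (hκ : 12 * (κ * (k : ℝ) ^ 2) ≤ δ)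
    (hh : 18 * ((k : ℝ) ^ 2 * (mismatch z zstar).card) ≤ δ * p)
    (hle : columnError Y z (r * lam) j a ≤ columnError Y z (r * lam) j (zstar j))
    (hor : ¬ OracleError lam δ zstar Y j a) :
    lam ^ 2 * gap zstar j a ≤
      16 / (δ ^ 2 * p) * (∑ i, colPerturb z zstar a j i * noise lam zstar Y i j) ^ 2 := by
  have hp' : (0 : ℝ) < p := by exact_mod_cast hp
  have hk1 : (1 : ℝ) ≤ (k : ℝ) ^ 2 := by
    have : (1 : ℝ) ≤ k := by exact_mod_cast NeZero.one_le
    nlinarith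
  have hκ0 : 0 ≤ κ := (abs_nonneg _).trans hr
  have hκ1 : 12 * κ ≤ δ := by nlinarith
  rcases eq_or_ne a (zstar j) with rfl | ha
  · rw [gap_self]
    simp only [mul_zero]
    positivity
  have hg := le_gap zstar ha
  set g := gap zstar j a with hg_def
  have hg0 : 0 < g := hp'.trans_le hg
  have hr0 : 0 < r := by
    have := (abs_le.1 hr).1
    linarith
  have hsum := le_sum_signal z zstar hr (by linarith) j a
  have hsub := columnError_sub Y z zstar lam r j a
  set S := ∑ i, (2 * (diff (zstar i) (zstar j) - r * diff (z i) (zstar j)) *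
      (diff (z i) (zstar j) - diff (z i) a) + r * (diff (z i) (zstar j) - diff (z i) a) ^ 2)
  set X := ∑ i, (diff (z i) (zstar j) - diff (z i) a) * noise lam zstar Y i j with hX
  set P := ∑ i, colPerturb z zstar a j i * noise lam zstar Y i j with hP
  have hXP : X = ∑ i, (diff (zstar i) (zstar j) - diff (zstar i) a) * noise lam zstar Y i j +
      P := by
    rw [hX, hP, ← Finset.sum_add_distrib]
    refine Finset.sum_congr rfl fun i _ => ?_
    unfold colPerturb
    ring
  have hneg : 2 * lam * X + lam ^ 2 * S ≤ 0 := by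
    by_contra hcon
    have := mul_pos hr0 (not_le.1 hcon)
    linarith
  -- As `g ≥ p`, the three losses are at most `δ/12`, `δ/6` and `δ/6` times `g`, together below
  -- `δ/2`.
  have hS : (1 - δ / 2) * g ≤ S := by
    refine le_trans ?_ hsum
    nlinarith
  have hS' := mul_le_mul_of_nonneg_left hS (sq_nonneg lam)
  unfold OracleError at hor
  rw [not_le, ← hg_def] at hor
  rw [hXP] at hneg
  have hlP : δ / 2 * (lam ^ 2 * g) ≤ -(2 * lam * P) := by nlinarith
  have hl2 : 0 < lam ^ 2 := by positivity
  have hsq : (δ / 2 * (lam ^ 2 * g)) ^ 2 ≤ (2 * lam * P) ^ 2 := by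
    rw [← neg_sq (2 * lam * P)]
    exact pow_le_pow_left₀ (by positivity) hlP 2
  have h7 : δ ^ 2 * (lam ^ 2 * g ^ 2) ≤ 16 * P ^ 2 := by
    have : lam ^ 2 * (δ ^ 2 * (lam ^ 2 * g ^ 2)) ≤ lam ^ 2 * (16 * P ^ 2) := by
      calc lam ^ 2 * (δ ^ 2 * (lam ^ 2 * g ^ 2)) = 4 * (δ / 2 * (lam ^ 2 * g)) ^ 2 := by ring
        _ ≤ 4 * (2 * lam * P) ^ 2 := by gcongr
        _ = lam ^ 2 * (16 * P ^ 2) := by ring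
    exact le_of_mul_le_mul_left this hl2
  rw [div_mul_eq_mul_div, le_div_iff₀ (by positivity)]
  calc lam ^ 2 * g * (δ ^ 2 * p) ≤ lam ^ 2 * g * (δ ^ 2 * g) := by gcongr
    _ = δ ^ 2 * (lam ^ 2 * g ^ 2) := by ring
    _ ≤ 16 * P ^ 2 := h7

/-- The noise behaves well with respect to the labels `z`. -/
def NoiseRegular (C lam : ℝ) (zstar : Fin p → ZMod k) (Y : Matrix (Fin p) (Fin p) ℝ)
    (z : Fin p → ZMod k) : Prop :=
  (∑ j, ∑ i, diff (z i) (z j) * noise lam zstar Y i j) ^ 2 ≤ C * p * designSq z ∧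
    ∀ a : ZMod k, ∑ j, (∑ i, colPerturb z zstar a j i * noise lam zstar Y i j) ^ 2 ≤
      C * p * (4 * (k : ℝ) ^ 2 * (mismatch z zstar).card)

/-- One step of the algorithm halves the loss up to oracle errors. -/
lemma loss_step_le [NeZero k] {Y : Matrix (Fin p) (Fin p) ℝ} {z z' zstar : Fin p → ZMod k}
    {lam α δ C : ℝ} (hstep : IsStep Y z z') (hα : 0 < α) (hα1 : α ≤ 1) (hδ : 0 < δ) (hδ1 : δ ≤ 1)
    (hC : 0 < C) (hp : 0 < p) (hlam : lam ≠ 0)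
    (hbal : ∀ a, ((Finset.univ.filter fun j => zstar j = a).card : ℝ) ≤ (1 - α) * p)
    (hh : 96 * ((mismatch z zstar).card * (k : ℝ) ^ 4) ≤ α * δ * p)
    (hx : 1152 * C * (k : ℝ) ^ 4 ≤ α * δ ^ 2 * (p * lam ^ 2))
    (hN : NoiseRegular C lam zstar Y z) :
    loss lam z' zstar ≤ oracleLoss lam δ zstar Y + 1 / 2 * loss lam z zstar := by
  classical
  obtain ⟨l, hl, hcol⟩ := hstep
  have hp' : (0 : ℝ) < p := by exact_mod_cast hp
  have hk : (1 : ℝ) ≤ k := by exact_mod_cast NeZero.one_le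
  set h : ℝ := ((mismatch z zstar).card : ℝ) with hh_def
  have hh0 : 0 ≤ h := Nat.cast_nonneg _
  have hk2 : (1 : ℝ) ≤ (k : ℝ) ^ 2 := one_le_pow₀ hk
  have hk4 : (k : ℝ) ^ 2 ≤ (k : ℝ) ^ 4 := pow_le_pow_right₀ hk (by norm_num)
  have hk34 : (k : ℝ) ^ 3 ≤ (k : ℝ) ^ 4 := pow_le_pow_right₀ hk (by norm_num)
  have hhk2 : h * (k : ℝ) ^ 2 ≤ h * (k : ℝ) ^ 4 := by gcongr
  have hhk0 : h ≤ h * (k : ℝ) ^ 4 := le_mul_of_one_le_right hh0 (hk2.trans hk4)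
  have hαδ : α * δ * p ≤ α * p := by
    have : α * δ ≤ α := mul_le_of_le_one_right hα.le hδ1
    gcongr
  have hαδ' : α * δ * p ≤ δ * p := by
    have : α * δ ≤ δ := mul_le_of_le_one_left hδ.le hα1
    gcongr
  -- The largest `κ` allowed by `gap_le_of_columnError_le`. It produces the constants `96 = 8 · 12`
  -- and `1152 = 8 · 12²` and the powers `k⁴` in the hypotheses.
  set κ : ℝ := δ / (12 * (k : ℝ) ^ 2) with hκ
  have hr : |l / lam - 1| ≤ κ := by
    refine abs_ratio_sub_one_le hl hα hp hlam hbal ?_ hN.1 (by positivity) ?_ ?_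
    · rw [← hh_def]
      linarith
    · rw [← hh_def, hκ, div_mul_eq_mul_div, le_div_iff₀ (by positivity)]
      linarith
    · rw [hκ, div_pow, div_mul_eq_mul_div, le_div_iff₀ (by positivity)]
      linarith
  have hll : l = l / lam * lam := by field_simp
  have hcolumn : ∀ j, lam ^ 2 * gap zstar j (z' j) ≤
      ∑ a : ZMod k, ((if OracleError lam δ zstar Y j a then lam ^ 2 * gap zstar j a else 0) +
      16 / (δ ^ 2 * p) * (∑ i, colPerturb z zstar a j i * noise lam zstar Y i j) ^ 2) := by
    intro j
    have hnn : ∀ a : ZMod k, 0 ≤ (if OracleError lam δ zstar Y j a then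
        lam ^ 2 * gap zstar j a else 0) := fun a => by
      have := gap_nonneg zstar j a
      split_ifs <;> positivity
    -- The selected label depends on the noise, so its term is bounded by the sum over all labels.
    -- This costs a factor `k` in the perturbation part.
    refine le_trans ?_ (Finset.single_le_sum (f := fun a : ZMod k =>
      (if OracleError lam δ zstar Y j a then lam ^ 2 * gap zstar j a else 0) +
      16 / (δ ^ 2 * p) * (∑ i, colPerturb z zstar a j i * noise lam zstar Y i j) ^ 2)
      (fun a _ => add_nonneg (hnn a) (by positivity)) (Finset.mem_univ (z' j)))
    by_cases hor : OracleError lam δ zstar Y j (z' j)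
    · simp only [hor, if_true]
      exact le_add_of_nonneg_right (by positivity)
    · simp only [hor, if_false, zero_add]
      refine gap_le_of_columnError_le hlam hp hδ hδ1 hr ?_ ?_ ?_ hor
      · rw [hκ]
        field_simp
        exact le_rfl
      · rw [← hh_def]
        linarith
      · rw [← hll]
        exact hcol j (zstar j)
  have hpert : ∑ j, ∑ a : ZMod k, 16 / (δ ^ 2 * p) *
      (∑ i, colPerturb z zstar a j i * noise lam zstar Y i j) ^ 2 ≤
      64 * C * (k : ℝ) ^ 3 * h / δ ^ 2 := by
    rw [Finset.sum_comm]
    simp_rw [← Finset.mul_sum]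
    calc _ ≤ 16 / (δ ^ 2 * p) * ∑ _a : ZMod k, C * p * (4 * (k : ℝ) ^ 2 * h) := by
          gcongr with a
          exact hN.2 a
      _ = 64 * C * (k : ℝ) ^ 3 * h / δ ^ 2 := by
          rw [Finset.sum_const, Finset.card_univ, ZMod.card, nsmul_eq_mul]
          field_simp
          ring
  -- The loss is at least `p λ*²` per mismatch, so this is at most half of the current loss.
  have hhalf : 64 * C * (k : ℝ) ^ 3 * h / δ ^ 2 ≤ 1 / 2 * (p * lam ^ 2 * h) := by
    rw [div_le_iff₀ (by positivity)]
    have h8 : 128 * C * (k : ℝ) ^ 3 ≤ δ ^ 2 * (p * lam ^ 2) := by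
      calc 128 * C * (k : ℝ) ^ 3 ≤ 1152 * C * (k : ℝ) ^ 4 := by gcongr; norm_num
        _ ≤ α * δ ^ 2 * (p * lam ^ 2) := hx
        _ ≤ 1 * δ ^ 2 * (p * lam ^ 2) := by gcongr
        _ = _ := by ring
    nlinarith [mul_le_mul_of_nonneg_right h8 hh0]
  have hcard := card_mismatch_le_loss lam z zstar
  rw [← hh_def] at hcard
  calc loss lam z' zstar = ∑ j, lam ^ 2 * gap zstar j (z' j) := loss_eq_sum_gap _ _ _
    _ ≤ ∑ j, ∑ a : ZMod k,
        ((if OracleError lam δ zstar Y j a then lam ^ 2 * gap zstar j a else 0) +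
        16 / (δ ^ 2 * p) * (∑ i, colPerturb z zstar a j i * noise lam zstar Y i j) ^ 2) :=
      Finset.sum_le_sum fun j _ => hcolumn j
    _ = oracleLoss lam δ zstar Y + ∑ j, ∑ a : ZMod k, 16 / (δ ^ 2 * p) *
        (∑ i, colPerturb z zstar a j i * noise lam zstar Y i j) ^ 2 := by
      simp_rw [Finset.sum_add_distrib]
      rfl
    _ ≤ oracleLoss lam δ zstar Y + 1 / 2 * loss lam z zstar := by linarith

end Step

/-! ### Uniform noise bounds, oracle errors and the contraction event -/

section Probability

variable {Ω : Type*} [MeasurableSpace Ω] {μ : Measure Ω} {p k : ℕ}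
  {lam : ℝ} {zstar : Fin p → ZMod k} {Y : Ω → Matrix (Fin p) (Fin p) ℝ}

lemma IsModel.lintegral_exp_sum_noise_le [IsProbabilityMeasure μ]
    (hY : IsModel μ lam zstar Y) (c : Fin p → Fin p → ℝ) :
    ∫⁻ ω, ENNReal.ofReal (Real.exp (∑ j, ∑ i, c i j * noise lam zstar (Y ω) i j)) ∂μ ≤
      ENNReal.ofReal (Real.exp ((∑ j, ∑ i, c i j ^ 2) / 2)) := by
  have h0 : 0 ≤ ∑ j, ∑ i, c i j ^ 2 := by positivity
  have h := hY.hasSubgaussianMGF_sum_noise c (V := ⟨_, h0⟩) le_rfl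
  have h1 := h.mgf_le 1
  have h2 := h.integrable_exp_mul 1
  simp only [mgf, one_mul, one_pow, mul_one] at h1 h2
  rw [← ofReal_integral_eq_lintegral_ofReal h2 (ae_of_all _ fun x => (Real.exp_pos _).le)]
  exact ENNReal.ofReal_le_ofReal h1

/-- Tail bound for the squared Frobenius-type form of the noise along a family of columns. -/
lemma IsModel.measureReal_sum_sq_col_ge_le [IsProbabilityMeasure μ]
    (hY : IsModel μ lam zstar Y) {c : Fin p → Fin p → ℝ}
    {V : ℝ} (hV : 0 < V) (hc : ∀ j, ∑ i, c i j ^ 2 ≤ V) (x : ℝ) :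
    μ.real {ω | 4 * V * x ≤ ∑ j, (∑ i, c i j * noise lam zstar (Y ω) i j) ^ 2} ≤
      2 ^ p * Real.exp (-x) := by
  have hm := hY.measurable_noise
  have h := measureReal_sum_sq_ge_le (μ := μ)
    (G := fun j ω => ∑ i, c i j * noise lam zstar (Y ω) i j)
    (fun j => by fun_prop) hV (fun g => ?_) x
  · simpa using h
  · have h1 := hY.lintegral_exp_sum_noise_le fun i j => g j * c i j
    simp_rw [mul_assoc, ← Finset.mul_sum] at h1
    refine h1.trans (ENNReal.ofReal_le_ofReal (Real.exp_le_exp.2 ?_))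
    gcongr
    rw [Finset.mul_sum]
    refine Finset.sum_le_sum fun j _ => ?_
    simp_rw [mul_pow, ← Finset.mul_sum]
    rw [mul_comm V]
    gcongr
    exact hc j

lemma IsModel.measureReal_sq_sum_ge_le [IsProbabilityMeasure μ]
    (hY : IsModel μ lam zstar Y) {c : Fin p → Fin p → ℝ}
    {V : ℝ} (hV : 0 < V) (hc : ∑ j, ∑ i, c i j ^ 2 ≤ V) (x : ℝ) :
    μ.real {ω | 4 * V * x ≤ (∑ j, ∑ i, c i j * noise lam zstar (Y ω) i j) ^ 2} ≤
      2 * Real.exp (-x) := by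
  have hm := hY.measurable_noise
  have h := measureReal_sum_sq_ge_le (μ := μ)
    (G := fun (_ : Unit) ω => ∑ j, ∑ i, c i j * noise lam zstar (Y ω) i j)
    (fun j => by fun_prop) hV (fun g => ?_) x
  · simpa using h
  · have h1 := hY.lintegral_exp_sum_noise_le fun i j => g () * c i j
    simp_rw [mul_assoc, ← Finset.mul_sum] at h1
    simp only [Finset.univ_unique, PUnit.default_eq_unit, Finset.sum_singleton]
    refine h1.trans (ENNReal.ofReal_le_ofReal (Real.exp_le_exp.2 ?_))
    simp_rw [mul_pow, ← Finset.mul_sum]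
    rw [mul_comm V]
    gcongr

lemma IsModel.measureReal_not_noiseRegular_le [IsProbabilityMeasure μ] [NeZero k]
    (hY : IsModel μ lam zstar Y) {C : ℝ}
    (z : Fin p → ZMod k) :
    μ.real {ω | ¬ NoiseRegular C lam zstar (Y ω) z} ≤
      (2 + k * 2 ^ p) * Real.exp (-(C * p / 4)) := by
  set E1 : Set Ω := {ω | ¬ (∑ j, ∑ i, diff (z i) (z j) * noise lam zstar (Y ω) i j) ^ 2 ≤
    C * p * designSq z} with hE1
  set E2 : ZMod k → Set Ω := fun a =>
    {ω | ¬ ∑ j, (∑ i, colPerturb z zstar a j i * noise lam zstar (Y ω) i j) ^ 2 ≤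
      C * p * (4 * (k : ℝ) ^ 2 * (mismatch z zstar).card)} with hE2
  have hsub : {ω | ¬ NoiseRegular C lam zstar (Y ω) z} ⊆ E1 ∪ ⋃ a ∈ Finset.univ, E2 a := by
    intro ω hω
    simp only [hE1, hE2, Set.mem_union, Set.mem_iUnion, Set.mem_ofPred_eq, Finset.mem_univ,
      exists_prop, true_and]
    by_contra hcon
    push Not at hcon
    exact hω hcon
  have h1 : μ.real E1 ≤ 2 * Real.exp (-(C * p / 4)) := by
    have hA : 0 ≤ designSq z := by
      unfold designSq
      positivity
    -- The tail bound needs a positive variance proxy. If the design vanishes, both sides of the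
    -- inequality are zero and the bad event is empty.
    rcases hA.eq_or_lt with hA0 | hA0
    · have hz : ∀ j i, diff (z i) (z j) = 0 := by
        intro j i
        unfold designSq at hA0
        have h2 := (Finset.sum_eq_zero_iff_of_nonneg
          fun j _ => Finset.sum_nonneg fun i _ => sq_nonneg (diff (z i) (z j))).1 hA0.symm j
          (Finset.mem_univ j)
        have h3 := (Finset.sum_eq_zero_iff_of_nonneg
          fun i _ => sq_nonneg (diff (z i) (z j))).1 h2 i (Finset.mem_univ i)
        simpa using h3
      have : E1 = ∅ := by
        ext ω
        simp [hE1, hz, ← hA0]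
      rw [this]
      simp
      positivity
    · refine le_trans (measureReal_mono ?_)
        (hY.measureReal_sq_sum_ge_le (c := fun i j => diff (z i) (z j)) hA0 le_rfl (C * p / 4))
      intro ω hω
      simp only [hE1, Set.mem_ofPred_eq, not_le] at hω ⊢
      linarith
  have h2 : ∀ a ∈ Finset.univ, μ.real (E2 a) ≤ 2 ^ p * Real.exp (-(C * p / 4)) := by
    intro a _
    have hV := sum_colPerturb_sq_le z zstar a
    rcases (mismatch z zstar).card.eq_zero_or_pos with h0 | h0
    · have hz : z = zstar := by
        funext i
        by_contra hi
        exact (Finset.card_ne_zero_of_mem (mem_mismatch.2 hi)) h0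
      have : E2 a = ∅ := by
        ext ω
        simp [hE2, hz, colPerturb, mismatch]
      rw [this]
      simp
      positivity
    · have hk : (0 : ℝ) < k := by exact_mod_cast NeZero.pos k
      have h0' : (0 : ℝ) < (mismatch z zstar).card := by exact_mod_cast h0
      refine le_trans (measureReal_mono ?_)
        (hY.measureReal_sum_sq_col_ge_le (c := fun i j => colPerturb z zstar a j i)
          (V := 4 * (k : ℝ) ^ 2 * (mismatch z zstar).card) (by positivity) hV (C * p / 4))
      intro ω hω
      simp only [hE2, Set.mem_ofPred_eq, not_le] at hω ⊢
      linarith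
  calc μ.real {ω | ¬ NoiseRegular C lam zstar (Y ω) z}
      ≤ μ.real (E1 ∪ ⋃ a ∈ Finset.univ, E2 a) := measureReal_mono hsub
    _ ≤ μ.real E1 + μ.real (⋃ a ∈ Finset.univ, E2 a) := measureReal_union_le _ _
    _ ≤ 2 * Real.exp (-(C * p / 4)) + ∑ _a : ZMod k, 2 ^ p * Real.exp (-(C * p / 4)) :=
      add_le_add h1 ((measureReal_biUnion_finset_le _ _).trans (Finset.sum_le_sum h2))
    _ = (2 + k * 2 ^ p) * Real.exp (-(C * p / 4)) := by
      rw [Finset.sum_const, Finset.card_univ, ZMod.card, nsmul_eq_mul]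
      ring

/-- Give `z` the weight `k⁻¹` to the power of its number of mismatches. The total weight factorises
over the coordinates, each factor being at most `2`, and every counted `z` weighs at least `k⁻ᵐ`. -/
lemma card_filter_mismatch_le [NeZero k] (zstar : Fin p → ZMod k) (m : ℕ) :
    ((Finset.univ.filter fun z : Fin p → ZMod k => (mismatch z zstar).card ≤ m).card : ℝ) ≤
      2 ^ p * (k : ℝ) ^ m := by
  have hk : (1 : ℝ) ≤ k := by exact_mod_cast NeZero.one_le
  have hk0 : (0 : ℝ) < k := by linarith
  have hw : ∀ z : Fin p → ZMod k, ((k : ℝ)⁻¹) ^ (mismatch z zstar).card =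
      ∏ i, (if z i = zstar i then (1 : ℝ) else (k : ℝ)⁻¹) := by
    intro z
    rw [Finset.prod_ite]
    simp [mismatch]
  have hsum : ∑ z : Fin p → ZMod k, ((k : ℝ)⁻¹) ^ (mismatch z zstar).card ≤ 2 ^ p := by
    simp_rw [hw]
    rw [← Fintype.prod_sum fun (i : Fin p) (a : ZMod k) =>
      if a = zstar i then (1 : ℝ) else (k : ℝ)⁻¹]
    calc _ ≤ ∏ _i : Fin p, (2 : ℝ) := by
          refine Finset.prod_le_prod (fun i _ => Finset.sum_nonneg fun a _ => by positivity)
            fun i _ => ?_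
          calc ∑ a : ZMod k, (if a = zstar i then (1 : ℝ) else (k : ℝ)⁻¹)
              ≤ ∑ a : ZMod k, ((if a = zstar i then (1 : ℝ) else 0) + (k : ℝ)⁻¹) := by
                gcongr with a
                have : (0 : ℝ) ≤ (k : ℝ)⁻¹ := by positivity
                split_ifs <;> linarith
            _ = 2 := by
                rw [Finset.sum_add_distrib, Finset.sum_ite_eq', Finset.sum_const,
                  Finset.card_univ, ZMod.card, nsmul_eq_mul, mul_inv_cancel₀ hk0.ne']
                norm_num
      _ = 2 ^ p := by simp
  set S := Finset.univ.filter fun z : Fin p → ZMod k => (mismatch z zstar).card ≤ m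
  have h1 : (S.card : ℝ) * ((k : ℝ)⁻¹) ^ m ≤ 2 ^ p := by
    calc (S.card : ℝ) * ((k : ℝ)⁻¹) ^ m = ∑ _z ∈ S, ((k : ℝ)⁻¹) ^ m := by simp
      _ ≤ ∑ z ∈ S, ((k : ℝ)⁻¹) ^ (mismatch z zstar).card := by
          refine Finset.sum_le_sum fun z hz => ?_
          exact pow_le_pow_of_le_one (by positivity) (inv_le_one_of_one_le₀ hk)
            (Finset.mem_filter.1 hz).2
      _ ≤ ∑ z : Fin p → ZMod k, ((k : ℝ)⁻¹) ^ (mismatch z zstar).card :=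
          Finset.sum_le_sum_of_subset_of_nonneg (Finset.subset_univ _)
            fun _ _ _ => by positivity
      _ ≤ 2 ^ p := hsum
  rw [inv_pow, ← div_eq_mul_inv, div_le_iff₀ (by positivity)] at h1
  exact h1

/-- With high probability the noise is regular with respect to all labels near `z*`. -/
lemma IsModel.measureReal_exists_not_noiseRegular_le [IsProbabilityMeasure μ] [NeZero k]
    (hY : IsModel μ lam zstar Y)
    (hp : 0 < p) (hkp : k ≤ p) {m : ℕ} (hm : k * m ≤ p) :
    μ.real {ω | ∃ z, (mismatch z zstar).card ≤ m ∧ ¬ NoiseRegular 32 lam zstar (Y ω) z} ≤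
      Real.exp (-(p : ℝ)) := by
  set S := Finset.univ.filter fun z : Fin p → ZMod k => (mismatch z zstar).card ≤ m with hS
  have hset : {ω | ∃ z, (mismatch z zstar).card ≤ m ∧ ¬ NoiseRegular 32 lam zstar (Y ω) z} =
      ⋃ z ∈ S, {ω | ¬ NoiseRegular 32 lam zstar (Y ω) z} := by
    ext ω
    simp [hS]
  have hp1 : (1 : ℝ) ≤ p := by exact_mod_cast hp
  have hexp1 : (2 : ℝ) ≤ Real.exp 1 := by
    have := Real.add_one_le_exp (1 : ℝ)
    linarith
  have h2p : (2 : ℝ) ^ p ≤ Real.exp p := by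
    calc (2 : ℝ) ^ p ≤ Real.exp 1 ^ p := by gcongr
      _ = Real.exp p := by rw [← Real.exp_nat_mul, mul_one]
  have hkexp : ∀ n : ℕ, (n : ℝ) ≤ Real.exp n := fun n => by
    have := Real.add_one_le_exp (n : ℝ)
    linarith
  have hkm : (k : ℝ) ^ m ≤ Real.exp p := by
    calc (k : ℝ) ^ m ≤ Real.exp k ^ m := by
          gcongr
          exact hkexp k
      _ = Real.exp ((m * k : ℕ) : ℝ) := by
          rw [← Real.exp_nat_mul]
          push_cast
          rfl
      _ ≤ Real.exp p := Real.exp_le_exp.2 (by rw [mul_comm]; exact_mod_cast hm)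
  have hk : (k : ℝ) ≤ Real.exp p :=
    le_trans (by exact_mod_cast hkp) (hkexp p)
  have h2e : (2 : ℝ) ≤ Real.exp p := hexp1.trans (Real.exp_le_exp.2 hp1)
  have hE1 : 1 ≤ Real.exp (p : ℝ) := by linarith
  rw [hset]
  calc μ.real (⋃ z ∈ S, {ω | ¬ NoiseRegular 32 lam zstar (Y ω) z})
      ≤ ∑ z ∈ S, μ.real {ω | ¬ NoiseRegular 32 lam zstar (Y ω) z} :=
        measureReal_biUnion_finset_le _ _
    _ ≤ ∑ _z ∈ S, (2 + k * 2 ^ p) * Real.exp (-(32 * p / 4)) :=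
        Finset.sum_le_sum fun z _ => hY.measureReal_not_noiseRegular_le z
    _ = S.card * ((2 + k * 2 ^ p) * Real.exp (-(32 * p / 4))) := by
        rw [Finset.sum_const, nsmul_eq_mul]
    -- The count gives `exp (2p)` because `k m ≤ p`, and the prefactor is at most `exp (3p)`. The
    -- constant `32` supplies `exp (-8p)`.
    _ ≤ (Real.exp p * Real.exp p) * ((Real.exp p * Real.exp p * Real.exp p) *
        Real.exp (-(32 * p / 4))) := by
        have hcard : (S.card : ℝ) ≤ Real.exp p * Real.exp p :=
          (card_filter_mismatch_le zstar m).trans (by gcongr)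
        have h3 : 2 + (k : ℝ) * 2 ^ p ≤ Real.exp p * Real.exp p * Real.exp p := by
          have h4 : (k : ℝ) * 2 ^ p ≤ Real.exp p * Real.exp p := by gcongr
          nlinarith
        gcongr
    _ = Real.exp (-(3 * p)) := by
        simp only [← Real.exp_add]
        congr 1
        ring
    _ ≤ Real.exp (-(p : ℝ)) := Real.exp_le_exp.2 (by linarith)

lemma IsModel.measureReal_oracleError_le [IsProbabilityMeasure μ] [NeZero k]
    (hY : IsModel μ lam zstar Y) (hlam : lam ≠ 0)
    (hp : 0 < p) {δ : ℝ} (hδ : δ ≤ 1) {j : Fin p} {a : ZMod k} (ha : a ≠ zstar j) :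
    μ.real {ω | OracleError lam δ zstar (Y ω) j a} ≤
      Real.exp (-((1 - δ) ^ 2 * (p * lam ^ 2) / 8)) := by
  have hg := le_gap zstar ha
  have hp' : (0 : ℝ) < p := by exact_mod_cast hp
  set g := gap zstar j a with hg_def
  have hg0 : 0 < g := hp'.trans_le hg
  let c : Fin p → Fin p → ℝ := fun i j' =>
    if j' = j then -(2 * lam) * (diff (zstar i) (zstar j) - diff (zstar i) a) else 0
  have hcsq : ∑ j', ∑ i, c i j' ^ 2 = 4 * lam ^ 2 * g := by
    rw [Finset.sum_eq_single j (fun j' _ hj => by simp [c, hj]) (by simp)]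
    simp only [c, if_true, mul_pow, ← Finset.mul_sum, hg_def, gap]
    ring
  have hV : 0 ≤ 4 * lam ^ 2 * g := by positivity
  have h := (hY.hasSubgaussianMGF_sum_noise c (V := ⟨_, hV⟩) hcsq.le).measure_ge_le
    (ε := (1 - δ) * (lam ^ 2 * g)) (mul_nonneg (by linarith) (by positivity))
  change _ ≤ Real.exp (-((1 - δ) * (lam ^ 2 * g)) ^ 2 / (2 * (4 * lam ^ 2 * g))) at h
  have hsum : ∀ ω, ∑ j', ∑ i, c i j' * noise lam zstar (Y ω) i j' = -(2 * lam * ∑ i,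
      (diff (zstar i) (zstar j) - diff (zstar i) a) * noise lam zstar (Y ω) i j) := by
    intro ω
    rw [Finset.sum_eq_single j (fun j' _ hj => by simp [c, hj]) (by simp)]
    simp only [c, if_true, Finset.mul_sum, ← Finset.sum_neg_distrib]
    refine Finset.sum_congr rfl fun i _ => ?_
    ring
  have hset : {ω | OracleError lam δ zstar (Y ω) j a} =
      {ω | (1 - δ) * (lam ^ 2 * g) ≤ ∑ j', ∑ i, c i j' * noise lam zstar (Y ω) i j'} := by
    ext ω
    simp only [Set.mem_ofPred_eq, hsum, OracleError, ← hg_def]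
    exact le_neg
  rw [hset]
  refine h.trans (Real.exp_le_exp.2 ?_)
  have h1 : -((1 - δ) * (lam ^ 2 * g)) ^ 2 / (2 * (4 * lam ^ 2 * g)) =
      -((1 - δ) ^ 2 * (g * lam ^ 2) / 8) := by
    field_simp
    ring
  rw [h1]
  gcongr

lemma IsModel.measurableSet_oracleError (hY : IsModel μ lam zstar Y) (δ : ℝ) (j : Fin p)
    (a : ZMod k) : MeasurableSet {ω | OracleError lam δ zstar (Y ω) j a} := by
  have hm := hY.measurable_noise
  exact measurableSet_le (by fun_prop) measurable_const

/-- Markov's inequality: there are `p k` pairs of a column and a label, each with loss at most `λ*²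
p k²`, hence the factor `p k³ (p λ*²)` in the mean. -/
lemma IsModel.measureReal_oracleLoss_ge_le [IsProbabilityMeasure μ] [NeZero k]
    (hY : IsModel μ lam zstar Y)
    (hlam : lam ≠ 0) (hp : 0 < p) {δ : ℝ} (hδ : δ ≤ 1) {B : ℝ} (s : ℝ)
    (hB : Real.exp s * (p * ((k : ℝ) ^ 3 * (p * lam ^ 2)) *
      Real.exp (-((1 - δ) ^ 2 * (p * lam ^ 2) / 8))) ≤ B) :
    μ.real {ω | B ≤ oracleLoss lam δ zstar (Y ω)} ≤ Real.exp (-s) := by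
  classical
  have hp' : (0 : ℝ) < p := by exact_mod_cast hp
  have hk : (0 : ℝ) < k := by exact_mod_cast NeZero.pos k
  set q := Real.exp (-((1 - δ) ^ 2 * (p * lam ^ 2) / 8)) with hq
  have hq0 : 0 < q := Real.exp_pos _
  set M := p * ((k : ℝ) ^ 3 * (p * lam ^ 2)) * q with hM
  have hM0 : 0 < M := by positivity
  have hterm : ∀ j a, (fun ω => if OracleError lam δ zstar (Y ω) j a then
      lam ^ 2 * gap zstar j a else 0) = Set.indicator {ω | OracleError lam δ zstar (Y ω) j a}
      fun _ => lam ^ 2 * gap zstar j a := fun j a => by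
    ext ω
    simp [Set.indicator_apply]
  have hint : ∀ j a, Integrable (fun ω => if OracleError lam δ zstar (Y ω) j a then
      lam ^ 2 * gap zstar j a else 0) μ := fun j a => by
    rw [hterm]
    exact (integrable_const _).indicator (hY.measurableSet_oracleError δ j a)
  have hle : ∀ j a, ∫ ω, (if OracleError lam δ zstar (Y ω) j a then
      lam ^ 2 * gap zstar j a else 0) ∂μ ≤ lam ^ 2 * (p * (k : ℝ) ^ 2) * q := by
    intro j a
    rw [hterm, integral_indicator_const _ (hY.measurableSet_oracleError δ j a), smul_eq_mul,
      mul_comm]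
    rcases eq_or_ne a (zstar j) with rfl | ha
    · rw [gap_self]
      simp only [mul_zero, zero_mul]
      positivity
    · have h1 := hY.measureReal_oracleError_le hlam hp hδ ha
      have h2 := gap_le zstar j a
      gcongr
  have hexp : ∫ ω, oracleLoss lam δ zstar (Y ω) ∂μ ≤ M := by
    unfold oracleLoss
    rw [integral_finsetSum _ fun j _ => integrable_finsetSum _ fun a _ => by
      convert hint j a]
    calc _ ≤ ∑ _j : Fin p, ∑ _a : ZMod k, lam ^ 2 * (p * (k : ℝ) ^ 2) * q := by
          refine Finset.sum_le_sum fun j _ => ?_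
          rw [integral_finsetSum _ fun a _ => by convert hint j a]
          refine Finset.sum_le_sum fun a _ => ?_
          convert hle j a
      _ = M := by
          simp only [Finset.sum_const, Finset.card_univ, ZMod.card, nsmul_eq_mul, Fintype.card_fin,
            hM]
          ring
  have hnn : ∀ ω, 0 ≤ oracleLoss lam δ zstar (Y ω) := fun ω => by
    unfold oracleLoss
    refine Finset.sum_nonneg fun j _ => Finset.sum_nonneg fun a _ => ?_
    have := gap_nonneg zstar j a
    split_ifs <;> positivity
  have hintl : Integrable (fun ω => oracleLoss lam δ zstar (Y ω)) μ := by
    unfold oracleLoss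
    refine integrable_finsetSum _ fun j _ => integrable_finsetSum _ fun a _ => ?_
    convert hint j a
  have hmarkov := mul_meas_ge_le_integral_of_nonneg (ae_of_all μ hnn) hintl B
  have hB0 : 0 < B := lt_of_lt_of_le (by positivity) hB
  have h3 : B * μ.real {ω | B ≤ oracleLoss lam δ zstar (Y ω)} ≤ B * Real.exp (-s) := by
    calc _ ≤ M := hmarkov.trans hexp
      _ = Real.exp s * M * Real.exp (-s) := by
          rw [Real.exp_neg]
          field_simp
      _ ≤ B * Real.exp (-s) := by gcongr
  exact le_of_mul_le_mul_left h3 hB0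

/-- Non-asymptotic form of the contraction of the loss along the iterates. -/
lemma IsModel.measureReal_contraction_ge [IsProbabilityMeasure μ] [NeZero k]
    (hY : IsModel μ lam zstar Y)
    {z : ℕ → Ω → Fin p → ZMod k} (hstep : ∀ t ω, IsStep (Y ω) (z t ω) (z (t + 1) ω))
    {α δ B η s : ℝ} (hα : 0 < α) (hα1 : α ≤ 1) (hδ : 0 < δ) (hδ1 : δ ≤ 1) (hp : 0 < p)
    (hlam : lam ≠ 0)
    (hbal : ∀ a, ((Finset.univ.filter fun j => zstar j = a).card : ℝ) ≤ (1 - α) * p)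
    (hkp : k ≤ p) (hx : 1152 * 32 * (k : ℝ) ^ 4 ≤ α * δ ^ 2 * (p * lam ^ 2))
    (hB : Real.exp (√(p * lam ^ 2)) * (p * ((k : ℝ) ^ 3 * (p * lam ^ 2)) *
      Real.exp (-((1 - δ) ^ 2 * (p * lam ^ 2) / 8))) ≤ B)
    (hB' : 192 * (B * (k : ℝ) ^ 4) ≤ α * δ * (p ^ 2 * lam ^ 2))
    (hs : 96 * (s * (k : ℝ) ^ 4) ≤ α * δ * (p ^ 2 * lam ^ 2))
    (hinit : 1 - η ≤ μ.real {ω | loss lam (z 0 ω) zstar ≤ s}) :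
    1 - η - Real.exp (-√(p * lam ^ 2)) - Real.exp (-(p : ℝ)) ≤
      μ.real {ω | ∀ t : ℕ, 1 ≤ t → loss lam (z t ω) zstar ≤
        B + 1 / 2 * loss lam (z (t - 1) ω) zstar} := by
  have hp' : (0 : ℝ) < p := by exact_mod_cast hp
  have hk : (1 : ℝ) ≤ k := by exact_mod_cast NeZero.one_le
  have hk4 : (0 : ℝ) < (k : ℝ) ^ 4 := by positivity
  -- The largest number of mismatches for which `loss_step_le` applies.
  set m : ℕ := ⌊α * δ * p / (96 * (k : ℝ) ^ 4)⌋₊ with hm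
  have hm_iff : ∀ h : ℕ, h ≤ m ↔ 96 * (h * (k : ℝ) ^ 4) ≤ α * δ * p := by
    intro h
    rw [hm, Nat.le_floor_iff (by positivity), le_div_iff₀ (by positivity)]
    constructor <;> intro h' <;> linarith
  have hkm : k * m ≤ p := by
    have h1 := (hm_iff m).1 le_rfl
    have h2 : (k : ℝ) ≤ (k : ℝ) ^ 4 := le_self_pow₀ hk (by norm_num)
    have h3 : α * δ * p ≤ 1 * p := by
      have : α * δ ≤ 1 := mul_le_one₀ hα1 hδ.le hδ1
      gcongr
    have h4 : (m : ℝ) * k ≤ m * (k : ℝ) ^ 4 := by gcongr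
    have h5 : (0 : ℝ) ≤ m * (k : ℝ) ^ 4 := by positivity
    have h6 : (k : ℝ) * m ≤ p := by linarith
    exact_mod_cast h6
  set I : Set Ω := {ω | loss lam (z 0 ω) zstar ≤ s}
  set E1 : Set Ω := {ω | ∃ z, (mismatch z zstar).card ≤ m ∧ ¬ NoiseRegular 32 lam zstar (Y ω) z}
  set E2 : Set Ω := {ω | B ≤ oracleLoss lam δ zstar (Y ω)}
  set F : Set Ω := {ω | ∀ t : ℕ, 1 ≤ t → loss lam (z t ω) zstar ≤
        B + 1 / 2 * loss lam (z (t - 1) ω) zstar}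
  have hsub : I ⊆ F ∪ (E1 ∪ E2) := by
    intro ω hI
    by_contra hcon
    simp only [Set.mem_union, not_or] at hcon
    obtain ⟨hF, hE1, hE2⟩ := hcon
    refine hF ?_
    have hreg : ∀ z, (mismatch z zstar).card ≤ m → NoiseRegular 32 lam zstar (Y ω) z := by
      intro z hz
      by_contra h
      exact hE1 ⟨z, hz, h⟩
    have hor : oracleLoss lam δ zstar (Y ω) ≤ B := (not_le.1 hE2).le
    have hpl : 0 < p * lam ^ 2 := by positivity
    have hnext : ∀ t, 96 * (loss lam (z t ω) zstar * (k : ℝ) ^ 4) ≤ α * δ * (p ^ 2 * lam ^ 2) →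
        loss lam (z (t + 1) ω) zstar ≤ B + 1 / 2 * loss lam (z t ω) zstar := by
      intro t ht
      have h1 : 96 * ((mismatch (z t ω) zstar).card * (k : ℝ) ^ 4) ≤ α * δ * p := by
        have h2 := mul_le_mul_of_nonneg_right (card_mismatch_le_loss lam (z t ω) zstar) hk4.le
        have h3 : p * lam ^ 2 * (96 * ((mismatch (z t ω) zstar).card * (k : ℝ) ^ 4)) ≤
            p * lam ^ 2 * (α * δ * p) := by linarith
        exact le_of_mul_le_mul_left h3 hpl
      have h4 := loss_step_le (hstep t ω) hα hα1 hδ hδ1 (by norm_num) hp hlam hbal h1 hx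
        (hreg _ ((hm_iff _).2 h1))
      linarith
    -- The neighbourhood is invariant: `hB'` makes `B` at most half of its radius, and the
    -- contraction term is at most the other half.
    have hall : ∀ t, 96 * (loss lam (z t ω) zstar * (k : ℝ) ^ 4) ≤
        α * δ * (p ^ 2 * lam ^ 2) := by
      intro t
      induction t with
      | zero =>
        have h1 := mul_le_mul_of_nonneg_right (show loss lam (z 0 ω) zstar ≤ s from hI) hk4.le
        linarith
      | succ t ih =>
        have h1 := mul_le_mul_of_nonneg_right (hnext t ih) hk4.le
        linarith
    intro t ht
    obtain ⟨t, rfl⟩ := Nat.exists_eq_add_of_le' ht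
    exact hnext t (hall t)
  have h1 : μ.real I ≤ μ.real F + (μ.real E1 + μ.real E2) :=
    (measureReal_mono hsub).trans ((measureReal_union_le _ _).trans
      (add_le_add_right (measureReal_union_le _ _) _))
  have h2 : μ.real E1 ≤ Real.exp (-(p : ℝ)) :=
    hY.measureReal_exists_not_noiseRegular_le hp hkp hkm
  have h3 : μ.real E2 ≤ Real.exp (-√(p * lam ^ 2)) :=
    hY.measureReal_oracleLoss_ge_le hlam hp hδ1 _ hB
  linarith

end Probability

/-! ### Passage to the limit -/

section Asymptotics

/-- Diagonalization: a property that is monotone in `e` and holds eventually for every fixed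
`e > 0` holds along a sequence that tends to zero. -/
lemma exists_tendsto_zero_of_eventually {P : ℕ → ℝ → Prop}
    (hmono : ∀ n e e', e ≤ e' → P n e → P n e') (hex : ∀ n, ∃ e, P n e)
    (hev : ∀ e, 0 < e → ∀ᶠ n in atTop, P n e) :
    ∃ e : ℕ → ℝ, Tendsto e atTop (𝓝 0) ∧ ∀ n, P n (e n) := by
  let S : ℕ → Set ℝ := fun n => {e | 0 ≤ e ∧ P n e}
  have hne : ∀ n, (S n).Nonempty := fun n => by
    obtain ⟨e, he⟩ := hex n
    exact ⟨max e 0, le_max_right _ _, hmono n e _ (le_max_left _ _) he⟩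
  have hbdd : ∀ n, BddBelow (S n) := fun n => ⟨0, fun e he => he.1⟩
  have hpos : ∀ n : ℕ, (0 : ℝ) < 1 / ((n : ℝ) + 1) := fun n => by positivity
  refine ⟨fun n => sInf (S n) + 1 / ((n : ℝ) + 1), ?_, fun n => ?_⟩
  · have h1 : Tendsto (fun n => sInf (S n)) atTop (𝓝 0) := by
      refine tendsto_order.2 ⟨fun a ha => ?_, fun a ha => ?_⟩
      · exact Eventually.of_forall fun n => ha.trans_le (le_csInf (hne n) fun e he => he.1)
      · filter_upwards [hev (a / 2) (by linarith)] with n hn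
        have : sInf (S n) ≤ a / 2 := csInf_le (hbdd n) ⟨by linarith, hn⟩
        linarith
    simpa using h1.add tendsto_one_div_add_atTop_nhds_zero_nat
  · obtain ⟨e, he, hlt⟩ := exists_lt_of_csInf_lt (hne n) (lt_add_of_pos_right _ (hpos n))
    exact hmono n e _ hlt.le he.2

/-- With `x = p λ*²`, this absorbs the Markov factor `exp √x` and the polynomial factor `k³ x ≤ x²`
into a small change of the exponent. -/
lemma eventually_exp_sqrt_mul_sq_le {c : ℝ} (hc : 0 < c) :
    ∀ᶠ x : ℝ in atTop, Real.exp (√x) * x ^ 2 ≤ Real.exp (c * x) := by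
  have h1 := (isLittleO_pow_exp_pos_mul_atTop 2 (half_pos hc)).bound zero_lt_one
  filter_upwards [h1, eventually_ge_atTop (4 / c ^ 2), eventually_gt_atTop 0] with x hx hx1 hx0
  rw [Real.norm_of_nonneg (sq_nonneg x), Real.norm_of_nonneg (Real.exp_pos _).le, one_mul] at hx
  have h2 : √x ≤ c / 2 * x := by
    rw [Real.sqrt_le_left (by positivity)]
    rw [div_le_iff₀ (by positivity)] at hx1
    nlinarith
  calc Real.exp (√x) * x ^ 2 ≤ Real.exp (c / 2 * x) * Real.exp (c / 2 * x) := by gcongr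
    _ = Real.exp (c * x) := by
      rw [← Real.exp_add]
      congr 1
      ring

/-- Covers the indices where the asymptotic conditions still fail. A large `e` makes the exponent
equal to the trivial bound `L` on the loss, and `L ≤ p exp L`. -/
lemma exists_loss_le_exp {p k : ℕ} [NeZero k] (lam : ℝ) (zstar : Fin p → ZMod k) :
    ∃ e : ℝ, ∀ z : Fin p → ZMod k,
      loss lam z zstar ≤ p * Real.exp (-((1 + -e) * (p * lam ^ 2 / 8))) := by
  set L := lam ^ 2 * (p ^ 2 * (k : ℝ) ^ 2) with hL
  rcases (show 0 ≤ p * lam ^ 2 by positivity).eq_or_lt with h0 | h0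
  · refine ⟨0, fun z => (loss_le lam z zstar).trans ?_⟩
    have : lam ^ 2 * (p ^ 2 * (k : ℝ) ^ 2) = 0 := by
      calc lam ^ 2 * (p ^ 2 * (k : ℝ) ^ 2) = (p * lam ^ 2) * (p * (k : ℝ) ^ 2) := by ring
        _ = 0 := by rw [← h0, zero_mul]
    rw [this]
    positivity
  · refine ⟨1 + 8 * L / (p * lam ^ 2), fun z => (loss_le lam z zstar).trans ?_⟩
    have hp : (1 : ℝ) ≤ p := by
      rcases Nat.eq_zero_or_pos p with rfl | hp
      · simp at h0
      · exact_mod_cast hp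
    have h1 : -((1 + -(1 + 8 * L / (p * lam ^ 2))) * (p * lam ^ 2 / 8)) = L := by
      generalize (p : ℝ) * lam ^ 2 = x at h0
      have := h0.ne'
      field_simp
      ring
    rw [h1, ← hL]
    have h2 := Real.add_one_le_exp L
    nlinarith [Real.exp_pos L]

end Asymptotics

end ZkSync

/-! ### The theorem: choice of constants and diagonalization -/

theorem theorem11
    (p k : ℕ → ℕ) (hk : ∀ n, 1 ≤ k n)
    (lam : ℕ → ℝ) (zstar : (n : ℕ) → Fin (p n) → ZMod (k n))
    (Ω : ℕ → Type*) [∀ n, MeasurableSpace (Ω n)]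
    (μ : (n : ℕ) → Measure (Ω n)) [∀ n, IsProbabilityMeasure (μ n)]
    -- the data, and the iterates `z n t = z^(t)`
    (Y : (n : ℕ) → Ω n → Matrix (Fin (p n)) (Fin (p n)) ℝ)
    (hY : ∀ n, ZkSync.IsModel (μ n) (lam n) (zstar n) (Y n))
    (z : (n : ℕ) → ℕ → Ω n → Fin (p n) → ZMod (k n))
    (hz_meas : ∀ n t x, MeasurableSet (z n t ⁻¹' {x}))
    (hz_step : ∀ n t ω, ZkSync.IsStep (Y n ω) (z n t ω) (z n (t + 1) ω))
    -- growth conditions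
    (hpk : Tendsto (fun n => (p n : ℝ) / (k n : ℝ) ^ 2) atTop atTop)
    (hsnr : Tendsto (fun n => (p n : ℝ) * lam n ^ 2 / (k n : ℝ) ^ 4) atTop atTop)
    -- balanced labels
    (α : ℝ) (hα : 0 < α)
    (hbal : ∀ (n : ℕ) (a : ZMod (k n)),
      ((Finset.univ.filter fun j => zstar n j = a).card : ℝ) ≤ (1 - α) * (p n : ℝ))
    -- initialization
    (η ρ : ℕ → ℝ) (hρ : Tendsto ρ atTop (𝓝 0))
    (hinit : ∀ n, 1 - η n ≤
      (μ n).real {ω | ZkSync.loss (lam n) (z n 0 ω) (zstar n) ≤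
        ρ n * ((p n : ℝ) ^ 2 * lam n ^ 2 / (k n : ℝ) ^ 6)}) :
    ∃ ε : ℕ → ℝ, Tendsto ε atTop (𝓝 0) ∧ ∀ n,
      1 - η n - Real.exp (-√((p n : ℝ) * lam n ^ 2)) - Real.exp (-(p n : ℝ)) ≤
        (μ n).real {ω | ∀ t : ℕ, 1 ≤ t →
          ZkSync.loss (lam n) (z n t ω) (zstar n) ≤
            (p n : ℝ) * Real.exp (-((1 + ε n) * ((p n : ℝ) * lam n ^ 2 / 8)))
              + 1 / 2 * ZkSync.loss (lam n) (z n (t - 1) ω) (zstar n)} := by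
  have hkne : ∀ n, NeZero (k n) := fun n => ⟨by have := hk n; omega⟩
  let P : ℕ → ℝ → Prop := fun n e =>
    1 - η n - Real.exp (-√((p n : ℝ) * lam n ^ 2)) - Real.exp (-(p n : ℝ)) ≤
      (μ n).real {ω | ∀ t : ℕ, 1 ≤ t → ZkSync.loss (lam n) (z n t ω) (zstar n) ≤
        (p n : ℝ) * Real.exp (-((1 + -e) * ((p n : ℝ) * lam n ^ 2 / 8)))
          + 1 / 2 * ZkSync.loss (lam n) (z n (t - 1) ω) (zstar n)}
  have hmono : ∀ n e e', e ≤ e' → P n e → P n e' := by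
    intro n e e' hee h
    refine h.trans (measureReal_mono fun ω hω t ht => (hω t ht).trans ?_)
    gcongr
  have hex : ∀ n, ∃ e, P n e := by
    intro n
    obtain ⟨e, he⟩ := ZkSync.exists_loss_le_exp (lam n) (zstar n)
    refine ⟨e, ?_⟩
    have huniv : {ω | ∀ t : ℕ, 1 ≤ t → ZkSync.loss (lam n) (z n t ω) (zstar n) ≤
        (p n : ℝ) * Real.exp (-((1 + -e) * ((p n : ℝ) * lam n ^ 2 / 8)))
          + 1 / 2 * ZkSync.loss (lam n) (z n (t - 1) ω) (zstar n)} = Set.univ := by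
      refine Set.eq_univ_of_forall fun ω t _ => (he (z n t ω)).trans (le_add_of_nonneg_right ?_)
      have := ZkSync.loss_nonneg (lam n) (z n (t - 1) ω) (zstar n)
      positivity
    have h1 : 1 - η n ≤ 1 := (hinit n).trans measureReal_le_one
    have h2 := Real.exp_pos (-√((p n : ℝ) * lam n ^ 2))
    have h3 := Real.exp_pos (-(p n : ℝ))
    simp only [P]
    rw [huniv, probReal_univ]
    linarith
  have hk1 : ∀ n, (1 : ℝ) ≤ k n := fun n => by exact_mod_cast hk n
  have hsnr' : Tendsto (fun n => (p n : ℝ) * lam n ^ 2) atTop atTop :=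
    tendsto_atTop_mono (fun n => div_le_self (by positivity) (one_le_pow₀ (hk1 n))) hsnr
  have hev : ∀ e, 0 < e → ∀ᶠ n in atTop, P n e := by
    intro e he
    -- The cap `1/2` keeps the exponent at most `-x / 16`. With `δ = e'/4`, `(1 - δ)² ≥ 1 - e'/2`,
    -- so one half of the slack `e' x / 8` pays for `δ` and the other half, `e' x / 16`, for the
    -- factor `exp √x · x²`.
    set e' := min e (1 / 2) with he'
    have he'0 : 0 < e' := lt_min he (by norm_num)
    have he'1 : e' ≤ 1 / 2 := min_le_right _ _
    set δ := e' / 4 with hδ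
    have hδ0 : 0 < δ := by positivity
    have hδ1 : δ ≤ 1 := by linarith
    have hexp : ∀ᶠ x : ℝ in atTop, Real.exp (-(1 / 16) * x) ≤ α * δ / 192 := by
      have : Tendsto (fun x : ℝ => Real.exp (-(1 / 16) * x)) atTop (𝓝 0) :=
        Real.tendsto_exp_atBot.comp (tendsto_id.const_mul_atTop_of_neg (by norm_num))
      exact (this.eventually_lt_const (by positivity)).mono fun x hx => hx.le
    filter_upwards [hpk.eventually_ge_atTop 1,
      hsnr.eventually_ge_atTop (max 1 (1152 * 32 / (α * δ ^ 2))),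
      hsnr'.eventually (ZkSync.eventually_exp_sqrt_mul_sq_le (c := e' / 16) (by positivity)),
      hsnr'.eventually hexp,
      hρ.eventually_lt_const (show 0 < α * δ / 96 by positivity)] with n h1 h2 h3 h4 h5
    refine hmono n e' e (min_le_left _ _) ?_
    have hkp := hk1 n
    have hk2 : (1 : ℝ) ≤ (k n : ℝ) ^ 2 := one_le_pow₀ hkp
    have hk4 : (1 : ℝ) ≤ (k n : ℝ) ^ 4 := one_le_pow₀ hkp
    have hk34 : (k n : ℝ) ^ 3 ≤ (k n : ℝ) ^ 4 := pow_le_pow_right₀ hkp (by norm_num)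
    rw [le_div_iff₀ (by positivity), one_mul] at h1
    have hkk : (k n : ℝ) ≤ (k n : ℝ) ^ 2 := le_self_pow₀ hkp (by norm_num)
    have hp1 : (1 : ℝ) ≤ p n := hk2.trans h1
    have hp : 0 < p n := by exact_mod_cast hp1
    have h21 := (le_max_left _ _).trans h2
    have h22 := (le_max_right _ _).trans h2
    rw [le_div_iff₀ (by positivity)] at h21 h22
    rw [one_mul] at h21
    set x := (p n : ℝ) * lam n ^ 2 with hx
    have hx1 : 1 ≤ x := hk4.trans h21
    have hlam : lam n ≠ 0 := by
      rintro h0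
      rw [hx, h0] at hx1
      norm_num at hx1
    have hα1 : α ≤ 1 := by
      have h6 : 0 ≤ (1 - α) * (p n : ℝ) := (Nat.cast_nonneg _).trans (hbal n 0)
      have h7 := nonneg_of_mul_nonneg_left h6 (by linarith)
      linarith
    have hpx : (p n : ℝ) ^ 2 * lam n ^ 2 = p n * x := by
      rw [hx]
      ring
    refine (hY n).measureReal_contraction_ge (hz_step n) hα hα1 hδ0 hδ1 hp hlam (hbal n)
      (by exact_mod_cast hkk.trans h1) ?_ ?_ ?_ ?_ (hinit n)
    · rw [div_mul_eq_mul_div, div_le_iff₀ (by positivity)] at h22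
      linarith
    · calc Real.exp √x * (p n * ((k n : ℝ) ^ 3 * x) * Real.exp (-((1 - δ) ^ 2 * x / 8)))
          ≤ Real.exp √x * (p n * (x * x) * Real.exp (-((1 - 2 * δ) * x / 8))) := by
            gcongr
            · exact hk34.trans h21
            · nlinarith
        _ = p n * ((Real.exp √x * x ^ 2) * Real.exp (-((1 - 2 * δ) * x / 8))) := by ring
        _ ≤ p n * (Real.exp (e' / 16 * x) * Real.exp (-((1 - 2 * δ) * x / 8))) := by gcongr
        _ = p n * Real.exp (-((1 + -e') * (x / 8))) := by
            rw [← Real.exp_add, hδ]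
            congr 2
            ring
    · have h6 : Real.exp (-((1 + -e') * (x / 8))) ≤ α * δ / 192 := by
        refine le_trans (Real.exp_le_exp.2 ?_) h4
        nlinarith
      rw [hpx]
      calc 192 * (p n * Real.exp (-((1 + -e') * (x / 8))) * (k n : ℝ) ^ 4)
          ≤ 192 * (p n * (α * δ / 192) * x) := by gcongr
        _ = α * δ * (p n * x) := by ring
    · rw [hpx]
      calc 96 * (ρ n * (p n * x / (k n : ℝ) ^ 6) * (k n : ℝ) ^ 4)
          ≤ 96 * (α * δ / 96 * (p n * x / (k n : ℝ) ^ 6) * (k n : ℝ) ^ 4) := by gcongr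
        _ = α * δ * (p n * x) / (k n : ℝ) ^ 2 := by
            field_simp
        _ ≤ α * δ * (p n * x) := div_le_self (by positivity) hk2
  obtain ⟨e, he0, heP⟩ := ZkSync.exists_tendsto_zero_of_eventually hmono hex hev
  exact ⟨fun n => -e n, by simpa using he0.neg, heP⟩
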